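/- Write points of $\mathbb{R}^4$ as $\mathbf{s}=(s_1,s_2,s_3,s_4)=\sum_i s_i\omega_i$. Let $(\,,\,)$ be the symmetric bilinear form $$(\mathbf{s},\mathbf{t})=\tfrac18\Bigl(2\sum_i s_it_i-\bigl(\sum_i s_i\bigr)\bigl(\sum_i t_i\bigr)\Bigr),$$ and let $\alpha_i$ be the vector with $i$-th coordinate $2$ and other coordinates $-2$. Then $(\alpha_i,\mathbf{s})=s_i$, and $(\alpha_i,\alpha_j)$ is $2$ if $i=j$ and $-2$ otherwise. Let $W$ be the Apollonian group, generated by the reflections $\sigma_i(\mathbf{s})=\mathbf{s}-s_i\alpha_i$ $(1\le i\le 4)$. Let $C$ be the set of all $\mathbf{s}\in\mathbb{R}^4$ with all $s_i\ge 0$ and at most one $s_i=0$, and let $\bar C=\{\mathbf{s}: \text{all } s_i\ge 0\}$. The Apollonian cone is $A=\bigcup_{w\in W}w(C)$. Regard $A$, $w(C)$ and $w(\bar C)$ as subsets of $\mathbb{RP}^3$ (the images of their nonzero vectors); each $w(\bar C)$ is a simplex, with vertices $w(\omega_i)$ and with edges the sets of points $w(\mathbf{s})$, where $\mathbf{s}\in\bar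 C$ has two given coordinates equal to $0$. Let $$J=\{\mathbf{s}\in\mathbb{RP}^3:(\mathbf{s},\mathbf{s})<0\},\qquad N=\{\mathbf{s}\in\mathbb{RP}^3:(\mathbf{s},\mathbf{s})=0\}.$$ $J$ is an open ball bounded by the sphere $N$, and both lie in the affine chart $s_1+s_2+s_3+s_4\neq0$ of $\mathbb{RP}^3$. Line segments and sides of planes are understood in this chart. A circle on $N$ is a plane section of $N$ with more than one point, and two circles are tangent if they meet in exactly one point. The four planes $s_1+s_2+s_3+s_4-2s_i=0$ cut $N$ in four mutually tangent circles. Let $\mathcal{T}$ be the Apollonian packing that they generate on $N$: the set of all circles in the quadruples obtained from these four circles by repeatedly replacing one circle of a quadruple by the other circle on $N$ that is tangent to the remaining three. Theorem. (1) For each $S\in\mathcal{T}$ there is a unique point $\mathbf{p}_S\in\mathbb{RP}^3$ such that the cone on $S$ with apex $\mathbf{p}_S$ is tangent to $N$ along $S$, i.e. such that for each $\mathbf{x}\in S$ one has $\mathbf{x}\ne\mathbf{p}_S$ and the line through $\mathbf{p}_S$ and $\mathbf{x}$ meets $N$ only in $\mathbf{x}$. There is a unique way to choose for each $S\in\mathcal{T}$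 one of the two open spherical caps of $N$ with boundary $S$, called $O_S$, so that the caps $O_S$ $(S\in\mathcal{T})$ are pairwise disjoint. (2) Let $C_S$ be the bounded cone on $O_S$ with apex $\mathbf{p}_S$, the apex removed: the union of all half-open line segments from $\mathbf{p}_S$ (exclusive) to a point of $O_S$ (inclusive). Then, in $\mathbb{RP}^3$, $$A=J\cup\bigcup_{S\in\mathcal{T}}C_S.$$ (3) For each $w\in W$, each vertex of the simplex $w(\bar C)$ is $\mathbf{p}_S$ for some $S\in\mathcal{T}$, and each edge of $w(\bar C)$ is the line segment connecting $\mathbf{p}_S$ and $\mathbf{p}_{S'}$ for two tangent circles $S,S'\in\mathcal{T}$. -/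

import Mathlib

noncomputable section

namespace ApollonianCone

/-- Real `4`-space. A vector `s` is given by its coordinates `s₁, …, s₄` in the basis of
fundamental weights, i.e. it stands for `s₁ω₁ + s₂ω₂ + s₃ω₃ + s₄ω₄`. -/
abbrev V : Type := Fin 4 → ℝ

/-- Three-dimensional real projective space. -/
abbrev RP3 : Type := Projectivization ℝ V

/-- The Cartan matrix: `2` on the diagonal, `-2` off the diagonal. -/
def cartan (i j : Fin 4) : ℝ := if i = j then 2 else -2

/-- The fundamental weight `ωᵢ`. -/
def weight (i : Fin 4) : V := Pi.single i 1

/-- The simple root `αᵢ`; its `j`-th coordinate in the basis of fundamental weights is the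
Cartan matrix entry `(αᵢ, αⱼ)`. -/
def root (i : Fin 4) : V := fun j => cartan i j

/-- The height `s₁ + s₂ + s₃ + s₄`. -/
def height : V →ₗ[ℝ] ℝ := ∑ i, LinearMap.proj i

lemma height_apply (s : V) : height s = ∑ i, s i := by
  simp [height]

/-- The invariant symmetric bilinear form `( , )`, in weight coordinates. It is pinned down by
`pairing_root_root`: its Gram matrix on the simple roots is the Cartan matrix. -/
def pairing : LinearMap.BilinForm ℝ V :=
  LinearMap.mk₂ ℝ (fun s t => (2 * ∑ i, s i * t i - (∑ i, s i) * ∑ i, t i) / 8)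
    (by intro a b c; simp [Fin.sum_univ_four]; ring)
    (by intro k a b; simp [Fin.sum_univ_four]; ring)
    (by intro a b c; simp [Fin.sum_univ_four]; ring)
    (by intro k a b; simp [Fin.sum_univ_four]; ring)

lemma pairing_apply (s t : V) :
    pairing s t = (2 * ∑ i, s i * t i - (∑ i, s i) * ∑ i, t i) / 8 := rfl

lemma pairing_root_root (i j : Fin 4) : pairing (root i) (root j) = cartan i j := by
  fin_cases i <;> fin_cases j <;> simp [pairing_apply, root, cartan, Fin.sum_univ_four] <;> norm_num

lemma pairing_root_left (i : Fin 4) (s : V) : pairing (root i) s = s i := by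
  fin_cases i <;> simp [pairing_apply, root, cartan, Fin.sum_univ_four] <;> ring

lemma pairing_root_weight (i j : Fin 4) :
    pairing (root i) (weight j) = if i = j then 1 else 0 := by
  rw [pairing_root_left]
  simp [weight, Pi.single_apply]

lemma pairing_root_self (i : Fin 4) : pairing (root i) (root i) = 2 := by
  simp [pairing_root_root, cartan]

/-- The simple reflection `σᵢ(s) = s - (s, αᵢ) αᵢ`. -/
def simpleReflection (i : Fin 4) : V ≃ₗ[ℝ] V := Module.reflection (pairing_root_self i)

lemma simpleReflection_apply (i : Fin 4) (s : V) :
    simpleReflection i s = s - s i • root i := by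
  rw [simpleReflection, Module.reflection_apply, pairing_root_left]

/-- The Apollonian group `W`, generated by the four simple reflections. -/
def apollonianGroup : Subgroup (V ≃ₗ[ℝ] V) := Subgroup.closure (Set.range simpleReflection)

/-- The cone `C`: all coordinates are nonnegative and at most one of them vanishes. -/
def chamber : Set V := {s | (∀ i, 0 ≤ s i) ∧ ∀ i j, s i = 0 → s j = 0 → i = j}

/-- The closure of the cone `C`: all coordinates are nonnegative. -/
def closedChamber : Set V := {s | ∀ i, 0 ≤ s i}

lemma closure_chamber : closure chamber = closedChamber := by
  apply Set.Subset.antisymm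
  · apply closure_minimal
    · intro s hs
      exact hs.1
    · have : closedChamber = ⋂ i, {s : V | 0 ≤ s i} := by
        ext s; simp [closedChamber]
      rw [this]
      exact isClosed_iInter fun i => isClosed_le continuous_const (continuous_apply i)
  · intro s hs
    have hlim : Filter.Tendsto (fun n : ℕ => fun i => s i + 1 / ((n : ℝ) + 1)) Filter.atTop
        (nhds s) := by
      rw [tendsto_pi_nhds]
      intro i
      simpa using tendsto_const_nhds.add (tendsto_one_div_add_atTop_nhds_zero_nat (𝕜 := ℝ))
    refine mem_closure_of_tendsto hlim (Filter.Eventually.of_forall fun n => ?_)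
    have hpos : ∀ i, 0 < s i + 1 / ((n : ℝ) + 1) := fun i =>
      add_pos_of_nonneg_of_pos (hs i) (by positivity)
    exact ⟨fun i => (hpos i).le, fun i j h _ => absurd h (hpos i).ne'⟩

/-- The subset of projective space given by the nonzero vectors of a set `X` of vectors. -/
def toRP3 (X : Set V) : Set RP3 := {P | ∃ v ∈ X, ∃ hv : v ≠ 0, Projectivization.mk ℝ v hv = P}

/-- The Apollonian cone `A`, the union of all `w(C)` with `w ∈ W`, as a subset of `ℝP³`. -/
def apollonianCone : Set RP3 := toRP3 (⋃ w ∈ apollonianGroup, w '' chamber)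

/-- The closed face of the projective simplex `w(C̄)` whose vertices are the `w(ωₖ)`, `k ∈ K`:
the points `w(s)`, where `s ∈ C̄` and `sₖ = 0` for all `k ∉ K`. The vertices are the faces with
`K = {i}`, the edges those with `K = {i, j}`, `i ≠ j`. -/
def simplexFace (w : V ≃ₗ[ℝ] V) (K : Set (Fin 4)) : Set RP3 :=
  toRP3 (w '' {s | s ∈ closedChamber ∧ ∀ k, k ∉ K → s k = 0})

/-- The timelike ball `J`: the points `[s]` with `(s, s) < 0`. -/
def timelike : Set RP3 := {P | pairing P.rep P.rep < 0}

/-- The lightlike sphere `N`: the points `[s]` with `(s, s) = 0`. -/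
def lightlike : Set RP3 := {P | pairing P.rep P.rep = 0}

/-- The zero set of a linear form in projective space; it is a plane if the form is nonzero. -/
def plane (f : V →ₗ[ℝ] ℝ) : Set RP3 := {P | f P.rep = 0}

lemma exists_rep_mk (v : V) (hv : v ≠ 0) :
    ∃ a : ℝ, a ≠ 0 ∧ (Projectivization.mk ℝ v hv).rep = a • v := by
  obtain ⟨a, ha⟩ := Projectivization.exists_smul_eq_mk_rep ℝ v hv
  exact ⟨a, a.ne_zero, by rw [← ha]; rfl⟩

lemma mk_mem_timelike (v : V) (hv : v ≠ 0) :
    Projectivization.mk ℝ v hv ∈ timelike ↔ pairing v v < 0 := by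
  obtain ⟨a, ha, h⟩ := exists_rep_mk v hv
  have h2 : 0 < a * a := mul_self_pos.mpr ha
  change pairing (Projectivization.mk ℝ v hv).rep (Projectivization.mk ℝ v hv).rep < 0 ↔ _
  rw [h]
  simp only [map_smul, LinearMap.smul_apply, smul_eq_mul, ← mul_assoc]
  exact ⟨fun H => by by_contra! hc; nlinarith, fun H => mul_neg_of_pos_of_neg h2 H⟩

lemma mk_mem_lightlike (v : V) (hv : v ≠ 0) :
    Projectivization.mk ℝ v hv ∈ lightlike ↔ pairing v v = 0 := by
  obtain ⟨a, ha, h⟩ := exists_rep_mk v hv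
  change pairing (Projectivization.mk ℝ v hv).rep (Projectivization.mk ℝ v hv).rep = 0 ↔ _
  rw [h]
  simp [ha]

lemma mk_mem_plane (f : V →ₗ[ℝ] ℝ) (v : V) (hv : v ≠ 0) :
    Projectivization.mk ℝ v hv ∈ plane f ↔ f v = 0 := by
  obtain ⟨a, ha, h⟩ := exists_rep_mk v hv
  change f (Projectivization.mk ℝ v hv).rep = 0 ↔ _
  rw [h]
  simp [ha]

/-- The representative of height `1` of a point of the affine chart `s₁ + s₂ + s₃ + s₄ ≠ 0`
of `ℝP³`. (Outside of the chart the value is the meaningless `0`.) -/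
def affineRep (P : RP3) : V := (height P.rep)⁻¹ • P.rep

lemma affineRep_mk (v : V) (hv : v ≠ 0) :
    affineRep (Projectivization.mk ℝ v hv) = (height v)⁻¹ • v := by
  obtain ⟨a, ha, h⟩ := exists_rep_mk v hv
  rw [affineRep, h]
  rw [map_smul, smul_smul, smul_eq_mul]
  congr 1
  rw [mul_inv]
  field_simp

/-- The closed line segment between two points of the affine chart
`s₁ + s₂ + s₃ + s₄ ≠ 0` of `ℝP³`. -/
def lineSegment (P Q : RP3) : Set RP3 := toRP3 (segment ℝ (affineRep P) (affineRep Q))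

/-- The projective line through two distinct points. -/
def projectiveLine (P Q : RP3) : Set RP3 := {R | R.submodule ≤ P.submodule ⊔ Q.submodule}

/-- A circle on the sphere `N`: a plane section of `N` with more than one point. -/
def IsCircle (S : Set RP3) : Prop :=
  ∃ f : V →ₗ[ℝ] ℝ, f ≠ 0 ∧ S = lightlike ∩ plane f ∧ S.Nontrivial

/-- Two circles are tangent if they meet in exactly one point. -/
def AreTangent (S S' : Set RP3) : Prop := ∃ P, S ∩ S' = {P}

/-- The four circles cut out of `N` by the planes `s₁ + s₂ + s₃ + s₄ - 2 sᵢ = 0`. -/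
def baseCircle (i : Fin 4) : Set RP3 :=
  lightlike ∩ plane (height - (2 : ℝ) • LinearMap.proj i)

/-- The quadruples of circles obtained from the base quadruple by successively replacing one
circle by the other circle that is tangent to the remaining three. -/
inductive IsPackingQuadruple : (Fin 4 → Set RP3) → Prop
  | base : IsPackingQuadruple baseCircle
  | swap (q : Fin 4 → Set RP3) (i : Fin 4) (S : Set RP3) (hq : IsPackingQuadruple q)
      (hS : IsCircle S) (htan : ∀ j, j ≠ i → AreTangent S (q j)) (hne : S ≠ q i) :
      IsPackingQuadruple (Function.update q i S)

/-- The Apollonian packing `𝒯` on `N` generated by the base quadruple. -/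
def packing : Set (Set RP3) := {S | ∃ q, IsPackingQuadruple q ∧ ∃ i, q i = S}

/-- The cone on the circle `S` with apex `p` is tangent to `N` along `S`: for each `P ∈ S` the
line through `p` and `P` touches `N` at `P`, i.e. meets `N` in no other point. -/
def IsTangentApex (S : Set RP3) (p : RP3) : Prop :=
  ∀ P ∈ S, P ≠ p ∧ projectiveLine p P ∩ lightlike = {P}

/-- `O` is one of the two open spherical caps of `N` with boundary circle `S`: the part of `N`
strictly on one side of the plane of `S` in the affine chart (which contains `N`). -/
def IsOpenCap (S O : Set RP3) : Prop :=
  ∃ f : V →ₗ[ℝ] ℝ, f ≠ 0 ∧ S = lightlike ∩ plane f ∧ O = {P ∈ lightlike | 0 < f (affineRep P)}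

/-- `O` assigns to each circle of the packing one of the open caps that it bounds, in such a way
that all these caps are pairwise disjoint. -/
def IsCapChoice (O : packing → Set RP3) : Prop :=
  (∀ S : packing, IsOpenCap (S : Set RP3) (O S)) ∧ ∀ S S' : packing, S ≠ S' → Disjoint (O S) (O S')

/-- The bounded cone on the region `R` with apex `p`, the apex itself removed: the union of the
half-open line segments from `p` (exclusive) to the points of `R` (inclusive). -/
def boundedCone (p : RP3) (R : Set RP3) : Set RP3 := ⋃ P ∈ R, lineSegment p P \ {p}

end ApollonianCone

end

open ApollonianCone

namespace ApollonianCone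

/-! Everything is read off the orbit of the fundamental weights. One has `(ωᵢ, ωᵢ) = 1/8` and `(ωᵢ,
ωⱼ) = -1/8` for `i ≠ j`, so `w ωᵢ` lies outside `N` and is the pole of a circle, and the polar
circles of `w ωᵢ` and `w ωⱼ` touch at the lightlike point `w (ωᵢ + ωⱼ)`. The base circles are polar
to the `ωᵢ`. By Descartes' equation (`descartes`), the only other circle touching the three polar to
`w ωⱼ`, `j ≠ i`, is polar to `w σᵢ ωᵢ`. Since `σᵢ` fixes the other weights, a swap in a quadruple is
right multiplication of `w` by `σᵢ`, and the packing is the set of polar circles of the orbit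
vectors (`mem_packing_iff`). The apexes are the poles, which gives the statements on vertices and
edges.

The caps are the sides facing the poles. Distinct orbit vectors have product at most `-1/8`
(`pairing_weight_map_le`), so their sum is causal and cannot pair positively with a lightlike vector
of positive height: the caps are disjoint. The opposite cap of a circle meets both caps of a tangent
circle, so the choice is forced.

For the cone, a timelike vector is reflected into the chamber by descent on the height
(`exists_map_mem_chamber`). A point of a bounded cone is `c • v + x` with `v = w ωᵢ` and `x`
lightlike in the cap of `v`. The projection of `x` orthogonal to `v` is timelike, hence reducible by
elements fixing `v`, and adding back a nonnegative multiple of `v` stays inside the cone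
(`exists_map_chamber_of_cap`). Conversely, a chamber vector that is not timelike has one dominant
coordinate `i`, and lowering it yields a lightlike vector in the cap of `ωᵢ`
(`exists_eq_smul_weight_add`). -/

/-! ### Reflections, the form and the fundamental weights -/

lemma simpleReflection_apply_self (k : Fin 4) (s : V) : simpleReflection k s k = -s k := by
  simp [simpleReflection_apply, root, cartan]; ring

lemma simpleReflection_apply_of_ne {k l : Fin 4} (h : l ≠ k) (s : V) :
    simpleReflection k s l = s l + 2 * s k := by
  simp [simpleReflection_apply, root, cartan, h.symm]; ring

lemma height_simpleReflection (k : Fin 4) (s : V) :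
    height (simpleReflection k s) = height s + 4 * s k := by
  fin_cases k <;>
    simp [simpleReflection_apply, root, cartan, height_apply, Fin.sum_univ_four] <;> ring

lemma simpleReflection_mul_self (k : Fin 4) : simpleReflection k * simpleReflection k = 1 := by
  ext1 s
  exact Module.involutive_reflection (pairing_root_self k) s

lemma pairing_symm (s t : V) : pairing s t = pairing t s := by
  simp only [pairing_apply, Fin.sum_univ_four]; ring

lemma pairing_simpleReflection (k : Fin 4) (s t : V) :
    pairing (simpleReflection k s) (simpleReflection k t) = pairing s t := by
  rw [simpleReflection_apply, simpleReflection_apply]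
  simp only [map_sub, map_smul, LinearMap.sub_apply, LinearMap.smul_apply, smul_eq_mul,
    pairing_root_left, pairing_symm s (root k)]
  simp [root, cartan]
  ring

lemma pairing_map {w : V ≃ₗ[ℝ] V} (hw : w ∈ apollonianGroup) :
    ∀ s t : V, pairing (w s) (w t) = pairing s t := by
  induction hw using Subgroup.closure_induction with
  | mem x hx => obtain ⟨k, rfl⟩ := hx; exact pairing_simpleReflection k
  | one => intro s t; rfl
  | mul x y _ _ hx hy => intro s t; exact (hx _ _).trans (hy s t)
  | inv x _ hx =>
    intro s t
    rw [← hx]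
    congr 1
    · exact congrArg _ (LinearEquiv.apply_symm_apply x s)
    · exact LinearEquiv.apply_symm_apply x t

lemma simpleReflection_mem (k : Fin 4) : simpleReflection k ∈ apollonianGroup :=
  Subgroup.subset_closure ⟨k, rfl⟩

lemma pairing_weight_left (i : Fin 4) (s : V) :
    pairing (weight i) s = (2 * s i - height s) / 8 := by
  fin_cases i <;> simp [pairing_apply, weight, height_apply, Fin.sum_univ_four, Pi.single_apply]

lemma pairing_self (s : V) : pairing s s = (2 * ∑ i, s i ^ 2 - height s ^ 2) / 8 := by
  simp only [pairing_apply, height_apply, Fin.sum_univ_four]; ring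

lemma height_weight (i : Fin 4) : height (weight i) = 1 := by
  simp [height_apply, weight]

lemma pairing_weight_self (i : Fin 4) : pairing (weight i) (weight i) = 1 / 8 := by
  rw [pairing_weight_left, height_weight]; simp [weight]; norm_num

lemma pairing_weight_of_ne {i j : Fin 4} (h : i ≠ j) : pairing (weight i) (weight j) = -1 / 8 := by
  rw [pairing_weight_left, height_weight]; simp [weight, h]

lemma weight_ne_zero (i : Fin 4) : weight i ≠ 0 := by
  intro h; have := height_weight i; simp [h] at this

lemma simpleReflection_weight_of_ne {k i : Fin 4} (h : k ≠ i) :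
    simpleReflection k (weight i) = weight i := by
  rw [simpleReflection_apply]; simp [weight, h]

/-! ### The light cone and positivity of the height -/

/-- A Cauchy-Schwarz inequality: two causal vectors of positive height have nonpositive
product. -/
lemma pairing_nonpos_of_causal {a b : V} (ha : pairing a a ≤ 0) (ha' : 0 ≤ height a)
    (hb : pairing b b ≤ 0) (hb' : 0 ≤ height b) : pairing a b ≤ 0 := by
  rw [pairing_self] at ha hb
  rw [pairing_apply, ← height_apply a, ← height_apply b]
  have hcs := Finset.sum_mul_sq_le_sq_mul_sq Finset.univ a b
  have h1 : 0 ≤ ∑ i, a i ^ 2 := Finset.sum_nonneg fun i _ => sq_nonneg _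
  have h2 : 0 ≤ ∑ i, b i ^ 2 := Finset.sum_nonneg fun i _ => sq_nonneg _
  have h3 : (2 * ∑ i, a i * b i) ^ 2 ≤ (height a * height b) ^ 2 := by
    have : (2 * ∑ i, a i ^ 2) * (2 * ∑ i, b i ^ 2) ≤ height a ^ 2 * height b ^ 2 :=
      mul_le_mul (by linarith) (by linarith) (by positivity) (by positivity)
    nlinarith
  have := abs_le_of_sq_le_sq' h3 (mul_nonneg ha' hb')
  linarith [this.2]

lemma height_simpleReflection_pos (k : Fin 4) {s : V} (hs : pairing s s ≤ 0)
    (h : 0 < height s) : 0 < height (simpleReflection k s) := by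
  rw [height_simpleReflection]
  rw [pairing_self] at hs
  by_contra! hc
  -- Cauchy-Schwarz for the three coordinates other than `k`. Together with `2 ∑ sᵢ² ≤ (height s)²`
  -- it excludes `s k ≤ -height s / 4`.
  have key : (height s - s k) ^ 2 ≤ 3 * (∑ i, s i ^ 2 - s k ^ 2) := by
    fin_cases k <;> simp [height_apply, Fin.sum_univ_four] <;>
    nlinarith [sq_nonneg (s 0 - s 1), sq_nonneg (s 0 - s 2), sq_nonneg (s 0 - s 3),
      sq_nonneg (s 1 - s 2), sq_nonneg (s 1 - s 3), sq_nonneg (s 2 - s 3)]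
  nlinarith

lemma height_map_pos_of_causal {w : V ≃ₗ[ℝ] V} (hw : w ∈ apollonianGroup) {s : V}
    (hs : pairing s s ≤ 0) (h : 0 < height s) : 0 < height (w s) := by
  have key : ∀ x ∈ apollonianGroup, (∀ t : V, pairing t t ≤ 0 → 0 < height t →
      0 < height (x t)) := by
    intro x hx
    induction hx using Subgroup.closure_induction_left with
    | one => intro t _ ht; exact ht
    | mul_left x hx y hy ih =>
      obtain ⟨k, rfl⟩ := hx
      intro t ht ht'
      exact height_simpleReflection_pos k ((pairing_map hy t t).trans_le ht) (ih t ht ht')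
    | inv_mul_cancel x hx y hy ih =>
      obtain ⟨k, rfl⟩ := hx
      intro t ht ht'
      rw [inv_eq_of_mul_eq_one_left (simpleReflection_mul_self k)]
      exact height_simpleReflection_pos k ((pairing_map hy t t).trans_le ht) (ih t ht ht')
  exact key w hw s hs h

/-! ### Reduced words and products in the weight orbits -/

/-- `IsReducedWord k w` says that `w` is a nonempty product of simple reflections with the first
factor `σₖ` and no two equal consecutive factors. -/
inductive IsReducedWord : Fin 4 → (V ≃ₗ[ℝ] V) → Prop
  | single (k : Fin 4) : IsReducedWord k (simpleReflection k)
  | cons (m k : Fin 4) (w : V ≃ₗ[ℝ] V) (hmk : m ≠ k) (hw : IsReducedWord k w) :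
      IsReducedWord m (simpleReflection m * w)

lemma isReducedWord_simpleReflection_mul {w : V ≃ₗ[ℝ] V}
    (hw : w = 1 ∨ ∃ k, IsReducedWord k w) (m : Fin 4) :
    simpleReflection m * w = 1 ∨ ∃ k, IsReducedWord k (simpleReflection m * w) := by
  rcases hw with rfl | ⟨k, hk⟩
  · exact Or.inr ⟨m, by simpa using IsReducedWord.single m⟩
  · by_cases hmk : m = k
    · subst hmk
      cases hk with
      | single => exact Or.inl (simpleReflection_mul_self m)
      | cons _ k w _ hw =>
        rw [← mul_assoc, simpleReflection_mul_self, one_mul]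
        exact Or.inr ⟨k, hw⟩
    · exact Or.inr ⟨m, .cons m k w hmk hk⟩

lemma eq_one_or_isReducedWord {w : V ≃ₗ[ℝ] V} (hw : w ∈ apollonianGroup) :
    w = 1 ∨ ∃ k, IsReducedWord k w := by
  induction hw using Subgroup.closure_induction_left with
  | one => exact Or.inl rfl
  | mul_left x hx y _ ih =>
    obtain ⟨k, rfl⟩ := hx
    exact isReducedWord_simpleReflection_mul ih k
  | inv_mul_cancel x hx y _ ih =>
    obtain ⟨k, rfl⟩ := hx
    rw [inv_eq_of_mul_eq_one_left (simpleReflection_mul_self k)]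
    exact isReducedWord_simpleReflection_mul ih k

/-- The inequalities are chosen to reproduce themselves: they make every coordinate other than `k`
nonnegative, and applying `σₘ` with `m ≠ k` turns `t m` into `-t m` and each other `t l` into `t l +
2 t m`, so the new sums are `t l + t m`. -/
lemma IsReducedWord.map_closedChamber {k : Fin 4} {w : V ≃ₗ[ℝ] V} (hw : IsReducedWord k w)
    {s : V} (hs : s ∈ closedChamber) : w s k ≤ 0 ∧ ∀ l, l ≠ k → 0 ≤ w s l + w s k := by
  induction hw with
  | single k =>
    refine ⟨?_, fun l hl => ?_⟩
    · rw [simpleReflection_apply_self]; linarith [hs k]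
    · rw [simpleReflection_apply_self, simpleReflection_apply_of_ne hl]; linarith [hs k, hs l]
  | cons m k w hmk _ ih =>
    obtain ⟨h1, h2⟩ := ih
    have hm := h2 m hmk
    refine ⟨?_, fun l hl => ?_⟩
    · rw [LinearEquiv.mul_apply, simpleReflection_apply_self]; linarith
    · rw [LinearEquiv.mul_apply, simpleReflection_apply_self, simpleReflection_apply_of_ne hl]
      by_cases hlk : l = k
      · subst hlk; linarith
      · linarith [h2 l hlk]

/-- Unlike `height_map_pos_of_causal`, this covers spacelike vectors such as the weights. The
inequalities for reduced words give `height t ≥ -2 t k ≥ 0`, with equality only at `t = 0`. -/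
lemma height_map_pos {w : V ≃ₗ[ℝ] V} (hw : w ∈ apollonianGroup) {s : V}
    (hs : s ∈ closedChamber) (h0 : s ≠ 0) : 0 < height (w s) := by
  have hws : w s ≠ 0 := by simpa using h0
  have key : ∀ t : V, t ≠ 0 → (∃ k, t k ≤ 0 ∧ ∀ l, l ≠ k → 0 ≤ t l + t k) → 0 < height t := by
    rintro t ht ⟨k, hk, h⟩
    by_contra! hc
    apply ht
    have h0 := h 0
    have h1 := h 1
    have h2 := h 2
    have h3 := h 3
    rw [height_apply, Fin.sum_univ_four] at hc
    funext l
    fin_cases k <;> fin_cases l <;> simp at * <;> linarith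
  rcases eq_one_or_isReducedWord hw with rfl | ⟨k, hk⟩
  · change 0 < height s
    have hn : 0 ≤ height s := by rw [height_apply]; exact Finset.sum_nonneg fun i _ => hs i
    refine lt_of_le_of_ne hn fun he => h0 ?_
    rw [height_apply] at he
    funext i
    exact (Finset.sum_eq_zero_iff_of_nonneg fun i _ => hs i).1 he.symm i (Finset.mem_univ i)
  · exact key _ hws ⟨k, hk.map_closedChamber hs⟩

lemma weight_mem_closedChamber (i : Fin 4) : weight i ∈ closedChamber := by
  intro j; simp only [weight, Pi.single_apply]; split_ifs <;> norm_num

/-- The quantity `2 t i - height t` is `8 (ωᵢ, t)`. Applying `σₘ` leaves it unchanged for `i ≠ m`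
and lowers it by `8 t m` for `i = m`, where `t m ≥ 0` because the word is reduced. So the bound
persists once the weight has been moved. -/
lemma IsReducedWord.map_weight {k : Fin 4} {w : V ≃ₗ[ℝ] V} (hw : IsReducedWord k w)
    (j : Fin 4) : w (weight j) = weight j ∨
      ∀ i, 2 * w (weight j) i - height (w (weight j)) ≤ -1 := by
  have base : ∀ m, simpleReflection m (weight j) = weight j ∨
      ∀ i, 2 * simpleReflection m (weight j) i - height (simpleReflection m (weight j)) ≤ -1 := by
    intro m
    by_cases hmj : m = j
    · subst hmj
      refine Or.inr fun i => ?_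
      rw [height_simpleReflection, height_weight]
      by_cases him : i = m
      · subst him
        rw [simpleReflection_apply_self]; simp [weight]; norm_num
      · rw [simpleReflection_apply_of_ne him]; simp [weight, him]; norm_num
    · exact Or.inl (simpleReflection_weight_of_ne hmj)
  induction hw with
  | single k => exact base k
  | cons m k w hmk hw ih =>
    rw [LinearEquiv.mul_apply]
    rcases ih with ih | ih
    · rw [ih]; exact base m
    · refine Or.inr fun i => ?_
      obtain ⟨h1, h2⟩ := hw.map_closedChamber (weight_mem_closedChamber j)
      have hm := h2 m hmk
      rw [height_simpleReflection]
      by_cases him : i = m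
      · subst him
        rw [simpleReflection_apply_self]; linarith [ih i]
      · rw [simpleReflection_apply_of_ne him]; linarith [ih i]

/-- Distinct vectors in the orbits of the fundamental weights have product at most `-1/8`. -/
lemma pairing_weight_map_le {w : V ≃ₗ[ℝ] V} (hw : w ∈ apollonianGroup) {i j : Fin 4}
    (hne : w (weight j) ≠ weight i) : pairing (weight i) (w (weight j)) ≤ -1 / 8 := by
  by_cases h : w (weight j) = weight j
  · rw [h] at hne ⊢
    exact (pairing_weight_of_ne fun h => hne (by rw [h])).le
  · rcases eq_one_or_isReducedWord hw with rfl | ⟨k, hk⟩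
    · exact absurd rfl h
    · rw [pairing_weight_left]
      linarith [(hk.map_weight j).resolve_left h i]

/-! ### Reduction of timelike vectors to the chamber -/

/-- With `k`, `l` the other two indices, the difference of the two sides is `(sᵢ + sⱼ)² + (sₖ - sₗ)²
+ 2 (sᵢ² + sⱼ²)`. Hence two coordinates of a timelike vector of positive height have a positive sum,
bounded below when the height is bounded above. -/
lemma height_sq_sub_le {i j : Fin 4} (hij : i ≠ j) (s : V) :
    -(8 * pairing s s) ≤ 2 * (s i + s j) * height s := by
  rw [pairing_self]
  fin_cases i <;> fin_cases j <;> first | exact absurd rfl hij | skip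
  all_goals
    simp only [Fin.zero_eta, Fin.mk_one, Fin.reduceFinMk, height_apply, Fin.sum_univ_four]
    linarith [sq_nonneg (s 0 + s 1), sq_nonneg (s 0 + s 2), sq_nonneg (s 0 + s 3),
      sq_nonneg (s 1 + s 2), sq_nonneg (s 1 + s 3), sq_nonneg (s 2 + s 3),
      sq_nonneg (s 0 - s 1), sq_nonneg (s 0 - s 2), sq_nonneg (s 0 - s 3),
      sq_nonneg (s 1 - s 2), sq_nonneg (s 1 - s 3), sq_nonneg (s 2 - s 3),
      sq_nonneg (s 0), sq_nonneg (s 1), sq_nonneg (s 2), sq_nonneg (s 3)]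

lemma mem_chamber_of_timelike {s : V} (hs : pairing s s < 0) (h : s ∈ closedChamber) :
    s ∈ chamber := by
  refine ⟨h, fun i j hi hj => ?_⟩
  by_contra hij
  have := height_sq_sub_le hij s
  rw [hi, hj] at this
  linarith

/-- Reduction theory: a timelike vector of positive height can be moved into the chamber, by a
group element that fixes all fundamental weights orthogonal to the vector. -/
lemma exists_map_mem_chamber {s : V} (hs : pairing s s < 0) (hpos : 0 < height s) :
    ∃ w ∈ apollonianGroup, w s ∈ chamber ∧
      ∀ i, pairing (weight i) s = 0 → w (weight i) = weight i := by
  obtain ⟨e, he, hbound⟩ : ∃ e : ℝ, 0 < e ∧ 2 * height s * e ≤ -(8 * pairing s s) :=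
    ⟨-(8 * pairing s s) / (2 * height s), div_pos (by linarith) (by linarith),
      le_of_eq (by field_simp)⟩
  have gap : ∀ t : V, pairing t t = pairing s s → 0 < height t → height t ≤ height s →
      ∀ i j, i ≠ j → e ≤ t i + t j := by
    intro t ht h0 hle i j hij
    have := height_sq_sub_le hij t
    rw [ht] at this
    by_contra! hc
    have h1 : (t i + t j) * height t < e * height t := mul_lt_mul_of_pos_right hc h0
    have h2 : e * height t ≤ e * height s := mul_le_mul_of_nonneg_left hle he.le
    linarith
  suffices H : ∀ n : ℕ, ∀ t : V, pairing t t = pairing s s → 0 < height t →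
      height t ≤ height s → height t ≤ n * (4 * e) → ∃ w ∈ apollonianGroup, w t ∈ chamber ∧
        ∀ i, pairing (weight i) t = 0 → w (weight i) = weight i by
    obtain ⟨n, hn⟩ := exists_nat_ge (height s / (4 * e))
    exact H n s rfl hpos le_rfl ((div_le_iff₀ (by positivity)).1 hn)
  intro n
  induction n with
  | zero => intro t _ h0 _ h; simp at h; linarith
  | succ n ih =>
    intro t ht h0 hle hn
    by_cases hdom : t ∈ closedChamber
    · exact ⟨1, one_mem _, mem_chamber_of_timelike (s := t) (by rwa [ht]) hdom, fun _ _ => rfl⟩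
    obtain ⟨k, hk⟩ : ∃ k, t k < 0 := by simpa [closedChamber] using hdom
    -- Orthogonality to `ωᵢ` means `2 t i = height t > 0`, so a reflection in a negative coordinate
    -- is never `σᵢ`.
    have hfix : ∀ i, pairing (weight i) t = 0 →
        simpleReflection k (weight i) = weight i := by
      intro i hi
      rw [pairing_weight_left] at hi
      refine simpleReflection_weight_of_ne ?_
      rintro rfl
      linarith
    have ht' : pairing (simpleReflection k t) (simpleReflection k t) = pairing s s := by
      rw [pairing_simpleReflection, ht]
    have h0' : 0 < height (simpleReflection k t) :=
      height_simpleReflection_pos k (by rw [ht]; exact hs.le) h0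
    have hle' : height (simpleReflection k t) ≤ height s := by
      rw [height_simpleReflection]; linarith
    by_cases hdom' : simpleReflection k t ∈ closedChamber
    · exact ⟨_, simpleReflection_mem k, mem_chamber_of_timelike (by rwa [ht']) hdom', hfix⟩
    obtain ⟨j, hj⟩ : ∃ j, simpleReflection k t j < 0 := by simpa [closedChamber] using hdom'
    have hjk : j ≠ k := by
      rintro rfl
      rw [simpleReflection_apply_self] at hj
      linarith
    -- A single reflection may lower the height by very little. If a coordinate `j` is still
    -- negative afterwards, the gap forces `-t k > e`, so this step has lowered the height by more
    -- than `4 e`.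
    have hg := gap _ ht' h0' hle' j k hjk
    rw [simpleReflection_apply_self] at hg
    obtain ⟨w, hw, hwc, hwf⟩ := ih _ ht' h0' hle' (by
      rw [height_simpleReflection]; push_cast at hn; linarith)
    refine ⟨w * simpleReflection k, mul_mem hw (simpleReflection_mem k), hwc, fun i hi => ?_⟩
    rw [LinearEquiv.mul_apply, hfix i hi]
    refine hwf i ?_
    rw [← hfix i hi, pairing_simpleReflection, hi]

/-! ### Polar circles, poles and tangency -/

/-- The section of the lightlike sphere `N` by the polar plane of the vector `v`. -/
def polarCircle (v : V) : Set RP3 := lightlike ∩ plane (pairing v)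

lemma mk_mem_polarCircle {v x : V} (hx : x ≠ 0) :
    Projectivization.mk ℝ x hx ∈ polarCircle v ↔ pairing x x = 0 ∧ pairing v x = 0 := by
  rw [polarCircle, Set.mem_inter_iff, mk_mem_lightlike, mk_mem_plane]

lemma polarCircle_smul {c : ℝ} (hc : c ≠ 0) (v : V) : polarCircle (c • v) = polarCircle v := by
  ext P
  induction P using Projectivization.ind with
  | h x hx => simp [mk_mem_polarCircle, hc]

lemma baseCircle_eq (i : Fin 4) : baseCircle i = polarCircle (weight i) := by
  ext P
  induction P using Projectivization.ind with
  | h x hx =>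
    rw [mk_mem_polarCircle, baseCircle, Set.mem_inter_iff, mk_mem_lightlike, mk_mem_plane,
      pairing_weight_left]
    refine and_congr_right fun _ => ?_
    simp only [LinearMap.sub_apply, LinearMap.smul_apply, LinearMap.proj_apply, smul_eq_mul]
    constructor <;> intro h <;> linarith

lemma exists_pairing_eq (f : V →ₗ[ℝ] ℝ) : ∃ u, f = pairing u := by
  refine ⟨∑ i, f (weight i) • root i, ?_⟩
  refine LinearMap.pi_ext' fun i => LinearMap.ext_ring ?_
  have h : ∀ k, pairing (root k) (weight i) = if k = i then 1 else 0 := fun k =>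
    pairing_root_weight k i
  change f (weight i) = pairing _ (weight i)
  simp [h]

lemma ne_zero_of_pairing_ne_zero {u : V} (h : pairing u ≠ 0) : u ≠ 0 := by
  rintro rfl; exact h (map_zero _)

lemma pairing_ne_zero {u : V} (h : u ≠ 0) : pairing u ≠ 0 := by
  intro h0
  refine h (funext fun i => ?_)
  have := pairing_root_left i u
  rw [pairing_symm, h0] at this
  exact this.symm

lemma mk_eq_mk_of_eq_smul {u v : V} {c : ℝ} (hu : u ≠ 0) (hv : v ≠ 0) (h : u = c • v) :
    Projectivization.mk ℝ u hu = Projectivization.mk ℝ v hv :=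
  (Projectivization.mk_eq_mk_iff' ℝ u v hu hv).2 ⟨c, h.symm⟩

lemma exists_smul_of_mk_eq_mk {u v : V} {hu : u ≠ 0} {hv : v ≠ 0}
    (h : Projectivization.mk ℝ u hu = Projectivization.mk ℝ v hv) : ∃ c : ℝ, u = c • v := by
  obtain ⟨c, hc⟩ := (Projectivization.mk_eq_mk_iff' ℝ u v hu hv).1 h
  exact ⟨c, hc.symm⟩

lemma mk_mem_projectiveLine {u x r : V} (hu : u ≠ 0) (hx : x ≠ 0) (hr : r ≠ 0) :
    Projectivization.mk ℝ r hr ∈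
      projectiveLine (Projectivization.mk ℝ u hu) (Projectivization.mk ℝ x hx) ↔
      ∃ a b : ℝ, a • u + b • x = r := by
  change (Projectivization.mk ℝ r hr).submodule ≤ _ ↔ _
  simp only [Projectivization.submodule_mk]
  rw [Submodule.span_singleton_le_iff_mem, ← Submodule.span_insert, Submodule.mem_span_pair]

/-- The second lightlike point on the line through the lightlike point `x` and a point `u` not
orthogonal to `x`. -/
lemma exists_lightlike_of_pairing_ne_zero {u x : V} (hx : pairing x x = 0)
    (hux : pairing u x ≠ 0) : ∃ a b : ℝ, a • u + b • x ≠ 0 ∧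
      pairing (a • u + b • x) (a • u + b • x) = 0 ∧ ∀ c : ℝ, a • u + b • x ≠ c • x := by
  have hne : ∀ c : ℝ, (2 * pairing u x) • u + (-pairing u u) • x ≠ c • x := by
    intro c h
    have h1 := congrArg (fun y => pairing y x) h
    simp only [map_add, map_smul, LinearMap.add_apply, LinearMap.smul_apply, smul_eq_mul, hx,
      mul_zero, add_zero] at h1
    exact hux (by simpa using h1)
  refine ⟨2 * pairing u x, -pairing u u, fun h => hne 0 (by rw [h, zero_smul]), ?_, hne⟩
  simp only [map_add, map_smul, LinearMap.add_apply, LinearMap.smul_apply, smul_eq_mul, hx,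
    pairing_symm x u]
  ring

/-- The three lightlike vectors `ωᵢ + ωⱼ` span the hyperplane orthogonal to `ωᵢ`. They are the
points of tangency with the other circles, so these three points alone determine the pole. -/
lemma eq_smul_weight {i : Fin 4} {u : V}
    (h : ∀ j, j ≠ i → pairing u (weight i + weight j) = 0) : u = u i • weight i := by
  have h' : ∀ j, j ≠ i → u i + u j = height u := by
    intro j hj
    have := h j hj
    rw [map_add, pairing_symm u, pairing_symm u, pairing_weight_left, pairing_weight_left] at this
    linarith
  have h0 := h' 0
  have h1 := h' 1
  have h2 := h' 2
  have h3 := h' 3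
  rw [height_apply, Fin.sum_univ_four] at *
  funext l
  fin_cases i <;> fin_cases l <;> simp [weight] at * <;> linarith

lemma eq_smul_map_weight {w : V ≃ₗ[ℝ] V} (hw : w ∈ apollonianGroup) {i : Fin 4} {u : V}
    (h : ∀ j, j ≠ i → pairing u (w (weight i + weight j)) = 0) :
    ∃ c : ℝ, u = c • w (weight i) := by
  obtain ⟨u', rfl⟩ := w.surjective u
  have h' := eq_smul_weight (i := i) (u := u') fun j hj => by rw [← pairing_map hw, h j hj]
  exact ⟨u' i, by rw [← map_smul, ← h']⟩

lemma map_weight_ne_zero (w : V ≃ₗ[ℝ] V) (i : Fin 4) : w (weight i) ≠ 0 := by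
  simpa using weight_ne_zero i

lemma pairing_map_weight_self {w : V ≃ₗ[ℝ] V} (hw : w ∈ apollonianGroup) (i : Fin 4) :
    pairing (w (weight i)) (w (weight i)) = 1 / 8 := by
  rw [pairing_map hw, pairing_weight_self]

lemma weight_add_weight_ne_zero (i j : Fin 4) : weight i + weight j ≠ 0 := by
  intro h
  have := congrArg height h
  rw [map_add, height_weight, height_weight, map_zero] at this
  norm_num at this

lemma map_weight_add_weight_ne_zero (w : V ≃ₗ[ℝ] V) (i j : Fin 4) :
    w (weight i + weight j) ≠ 0 :=
  w.map_ne_zero_iff.2 (weight_add_weight_ne_zero i j)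

lemma mk_map_weight_add_weight_mem {w : V ≃ₗ[ℝ] V} (hw : w ∈ apollonianGroup) {i j : Fin 4}
    (hij : i ≠ j) : Projectivization.mk ℝ _ (map_weight_add_weight_ne_zero w i j) ∈
      polarCircle (w (weight i)) := by
  rw [mk_mem_polarCircle, pairing_map hw, pairing_map hw]
  simp only [map_add, LinearMap.add_apply, pairing_weight_self, pairing_weight_of_ne hij,
    pairing_weight_of_ne hij.symm]
  norm_num

lemma eq_smul_of_polarCircle_subset {w : V ≃ₗ[ℝ] V} (hw : w ∈ apollonianGroup) {i : Fin 4} {u : V}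
    (h : polarCircle (w (weight i)) ⊆ polarCircle u) : ∃ c : ℝ, u = c • w (weight i) :=
  eq_smul_map_weight hw fun _ hj =>
    ((mk_mem_polarCircle _).1 (h (mk_map_weight_add_weight_mem hw hj.symm))).2

lemma pairing_eq_zero_of_isTangent {u x : V} (hu : u ≠ 0) (hx : x ≠ 0) (hxx : pairing x x = 0)
    (h : projectiveLine (Projectivization.mk ℝ u hu) (Projectivization.mk ℝ x hx) ∩ lightlike =
      {Projectivization.mk ℝ x hx}) : pairing u x = 0 := by
  by_contra hne
  obtain ⟨a, b, h0, hr, hc⟩ := exists_lightlike_of_pairing_ne_zero hxx hne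
  have hmem : Projectivization.mk ℝ _ h0 ∈ projectiveLine (Projectivization.mk ℝ u hu)
      (Projectivization.mk ℝ x hx) ∩ lightlike :=
    ⟨(mk_mem_projectiveLine hu hx h0).2 ⟨a, b, rfl⟩, (mk_mem_lightlike _ h0).2 hr⟩
  rw [h] at hmem
  obtain ⟨c, hc'⟩ := exists_smul_of_mk_eq_mk hmem
  exact hc c hc'

/-- The apex of the tangent cone along a circle of the packing is the pole of its plane. -/
lemma isTangentApex_polarCircle {w : V ≃ₗ[ℝ] V} (hw : w ∈ apollonianGroup) (i : Fin 4)
    (p : RP3) : IsTangentApex (polarCircle (w (weight i))) p ↔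
      p = Projectivization.mk ℝ _ (map_weight_ne_zero w i) := by
  have hv := pairing_map_weight_self hw i
  constructor
  · intro h
    induction p using Projectivization.ind with
    | h u hu =>
      obtain ⟨c, hc⟩ := eq_smul_map_weight (i := i) (u := u) hw fun j hj => by
        have hmem := mk_map_weight_add_weight_mem hw hj.symm
        exact pairing_eq_zero_of_isTangent hu _ ((mk_mem_polarCircle _).1 hmem).1 (h _ hmem).2
      exact mk_eq_mk_of_eq_smul _ _ hc
  · rintro rfl P hP
    induction P using Projectivization.ind with
    | h x hx =>
      obtain ⟨hxx, hvx⟩ := (mk_mem_polarCircle hx).1 hP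
      refine ⟨fun he => ?_, Set.Subset.antisymm ?_ ?_⟩
      · obtain ⟨c, rfl⟩ := exists_smul_of_mk_eq_mk he
        rw [map_smul, hv, smul_eq_mul] at hvx
        apply hx
        rw [show c = 0 by linarith, zero_smul]
      · rintro R ⟨hR, hRl⟩
        induction R using Projectivization.ind with
        | h r hr =>
          obtain ⟨a, b, rfl⟩ := (mk_mem_projectiveLine _ hx hr).1 hR
          rw [mk_mem_lightlike] at hRl
          simp only [map_add, map_smul, LinearMap.add_apply, LinearMap.smul_apply, smul_eq_mul,
            hxx, hvx, hv, pairing_symm x] at hRl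
          have ha : a = 0 := by
            have : a * a = 0 := by linarith
            exact mul_self_eq_zero.1 this
          exact mk_eq_mk_of_eq_smul _ _ (c := b) (by rw [ha, zero_smul, zero_add])
      · rintro _ rfl
        exact ⟨(mk_mem_projectiveLine _ hx hx).2 ⟨0, 1, by simp⟩, hP.1⟩

/-- The circle of the orbit vectors `w ωᵢ` and `w ωⱼ` touch at the point `w (ωᵢ + ωⱼ)`. -/
lemma areTangent_polarCircle {w : V ≃ₗ[ℝ] V} (hw : w ∈ apollonianGroup) {i j : Fin 4}
    (hij : i ≠ j) : AreTangent (polarCircle (w (weight i))) (polarCircle (w (weight j))) := by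
  refine ⟨Projectivization.mk ℝ _ (map_weight_add_weight_ne_zero w i j),
    Set.Subset.antisymm ?_ ?_⟩
  · rintro P ⟨hi, hj⟩
    induction P using Projectivization.ind with
    | h x hx =>
      obtain ⟨z, rfl⟩ := w.surjective x
      rw [mk_mem_polarCircle, pairing_map hw, pairing_map hw, pairing_weight_left] at hi hj
      obtain ⟨hz, hi⟩ := hi
      obtain ⟨_, hj⟩ := hj
      refine mk_eq_mk_of_eq_smul _ _ (c := z i) ?_
      rw [← map_smul]
      congr 1
      -- Both `z i` and `z j` equal `height z / 2`, so their squares already exhaust the sum of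
      -- squares of the lightlike vector `z`.
      have hzl : ∀ l, l ≠ i → l ≠ j → z l = 0 := by
        intro l hli hlj
        rw [pairing_self] at hz
        have hle : ∑ k ∈ {l, i, j}, z k ^ 2 ≤ ∑ k, z k ^ 2 :=
          Finset.sum_le_univ_sum_of_nonneg fun k => sq_nonneg _
        rw [Finset.sum_insert (by simp [hli, hlj]), Finset.sum_pair hij] at hle
        have : z l ^ 2 ≤ 0 := by
          rw [show z i = height z / 2 by linarith, show z j = height z / 2 by linarith] at hle
          nlinarith
        exact pow_eq_zero_iff (two_ne_zero) |>.1 (le_antisymm this (sq_nonneg _))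
      funext l
      by_cases hli : l = i
      · subst hli; simp [weight, hij]
      · by_cases hlj : l = j
        · subst hlj; simp [weight, hli]; linarith
        · simp [weight, hli, hlj, hzl l hli hlj]
  · rintro _ rfl
    refine ⟨mk_map_weight_add_weight_mem hw hij, ?_⟩
    have := mk_map_weight_add_weight_mem hw hij.symm
    simpa only [add_comm (weight j)] using this

lemma polarCircle_nontrivial {w : V ≃ₗ[ℝ] V} (hw : w ∈ apollonianGroup) (i : Fin 4) :
    (polarCircle (w (weight i))).Nontrivial := by
  obtain ⟨j, k, hji, hki, hjk⟩ : ∃ j k : Fin 4, j ≠ i ∧ k ≠ i ∧ j ≠ k := by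
    revert i; decide
  refine ⟨_, mk_map_weight_add_weight_mem hw hji.symm, _, mk_map_weight_add_weight_mem hw hki.symm,
    fun h => ?_⟩
  obtain ⟨c, hc⟩ := exists_smul_of_mk_eq_mk h
  rw [← map_smul] at hc
  have hc := w.injective hc
  have h1 := congrFun hc i
  have h2 := congrFun hc k
  simp [weight, hji.symm, hki.symm, hki, hjk.symm] at h1 h2
  simp [← h1] at h2

lemma isCircle_polarCircle {w : V ≃ₗ[ℝ] V} (hw : w ∈ apollonianGroup) (i : Fin 4) :
    IsCircle (polarCircle (w (weight i))) :=
  ⟨pairing (w (weight i)), pairing_ne_zero (map_weight_ne_zero w i), rfl,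
    polarCircle_nontrivial hw i⟩

lemma AreTangent.ne {S S' : Set RP3} (h : AreTangent S S') (hS : S.Nontrivial) : S ≠ S' := by
  rintro rfl
  obtain ⟨P, hP⟩ := h
  rw [Set.inter_self] at hP
  exact Set.not_nontrivial_singleton (hP ▸ hS)

/-! ### Tangency and Descartes' equation -/

/-- Tangency of two plane sections, one of them polar to `v` with `(v, v) > 0`, forces the plane
spanned by the two poles to be degenerate. -/
lemma pairing_sq_of_areTangent {u v : V} (hv : pairing v v = 1 / 8)
    (h : AreTangent (polarCircle u) (polarCircle v)) :
    8 * pairing u v ^ 2 = pairing u u ∧ ∀ c : ℝ, u ≠ c • v := by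
  obtain ⟨P, hP⟩ := h
  induction P using Projectivization.ind with
  | h x hx =>
    have hmem : Projectivization.mk ℝ x hx ∈ polarCircle u ∩ polarCircle v := by rw [hP]; rfl
    obtain ⟨⟨hxx, hux⟩, -, hvx⟩ := And.imp (mk_mem_polarCircle hx).1 (mk_mem_polarCircle hx).1 hmem
    -- If `y` in the common polar line were not orthogonal to `x`, the line through `x` and `y`
    -- would meet `N` in a second common point. By duality `x` lies in the span of `u` and `v`; as
    -- `x` is orthogonal to both, their Gram determinant vanishes.
    have horth : ∀ y, pairing u y = 0 → pairing v y = 0 → pairing x y = 0 := by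
      intro y huy hvy
      by_contra hne
      rw [pairing_symm] at hne
      obtain ⟨a, b, h0, hr, hc⟩ := exists_lightlike_of_pairing_ne_zero hxx hne
      have hm : Projectivization.mk ℝ _ h0 ∈ polarCircle u ∩ polarCircle v := by
        constructor <;> rw [mk_mem_polarCircle] <;> exact ⟨hr, by simp [huy, hvy, hux, hvx]⟩
      rw [hP] at hm
      obtain ⟨c, hc'⟩ := exists_smul_of_mk_eq_mk hm
      exact hc c hc'
    have hspan : pairing x ∈ Submodule.span ℝ (Set.range ![pairing u, pairing v]) := by
      apply mem_span_of_iInf_ker_le_ker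
      intro y hy
      simp only [Submodule.mem_iInf, LinearMap.mem_ker] at hy
      exact horth y (hy 0) (hy 1)
    rw [Matrix.range_cons, Matrix.range_cons, Matrix.range_empty, Set.union_empty,
      Set.singleton_union, Submodule.mem_span_pair] at hspan
    obtain ⟨a, b, hab⟩ := hspan
    have hx' : ∀ y, pairing x y = a * pairing u y + b * pairing v y := fun y => by
      rw [← hab]; rfl
    have hxe : x = a • u + b • v := by
      by_contra hne
      refine pairing_ne_zero (sub_ne_zero.2 hne) (LinearMap.ext fun y => ?_)
      simp [hx' y]
    have hne : ∀ c : ℝ, x ≠ c • v := by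
      rintro c rfl
      rw [map_smul, hv, smul_eq_mul] at hvx
      apply hx
      rw [show c = 0 by linarith, zero_smul]
    have ha : a ≠ 0 := by
      rintro rfl
      exact hne b (by rw [hxe]; simp)
    have e1 := hx' u
    have e2 := hx' v
    rw [pairing_symm, hux, pairing_symm v u] at e1
    rw [pairing_symm, hvx, hv] at e2
    refine ⟨?_, ?_⟩
    · have hb : b = -8 * (a * pairing u v) := by linarith
      rw [hb] at e1
      have : a * (pairing u u - 8 * pairing u v ^ 2) = 0 := by linarith
      linarith [(mul_eq_zero.1 this).resolve_left ha]
    · rintro c rfl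
      exact hne (a * c + b) (by rw [hxe, smul_smul, ← add_smul])

/-- Descartes: the poles whose products with three of the fundamental weights have the square
that tangency requires. -/
lemma descartes {x a b c h : ℝ} (hh : h = x + a + b + c)
    (ha : (2 * a - h) ^ 2 = 2 * (x ^ 2 + a ^ 2 + b ^ 2 + c ^ 2) - h ^ 2)
    (hb : (2 * b - h) ^ 2 = 2 * (x ^ 2 + a ^ 2 + b ^ 2 + c ^ 2) - h ^ 2)
    (hc : (2 * c - h) ^ 2 = 2 * (x ^ 2 + a ^ 2 + b ^ 2 + c ^ 2) - h ^ 2) :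
    (a = 0 ∧ b = 0 ∧ c = 0) ∨ (a = -2 * x ∧ b = -2 * x ∧ c = -2 * x) ∨
      (x = 0 ∧ b = 0 ∧ c = 0) ∨ (x = 0 ∧ a = 0 ∧ c = 0) ∨ (x = 0 ∧ a = 0 ∧ b = 0) := by
  have h1 : (a - b) * (a + b - h) = 0 := by linear_combination (ha - hb) / 4
  have h2 : (a - c) * (a + c - h) = 0 := by linear_combination (ha - hc) / 4
  rcases mul_eq_zero.1 h1 with h1 | h1 <;> rcases mul_eq_zero.1 h2 with h2 | h2
  · obtain rfl : b = a := by linarith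
    obtain rfl : c = b := by linarith
    have : c * (c + 2 * x) = 0 := by rw [hh] at ha; linear_combination ha / 4
    rcases mul_eq_zero.1 this with h | h
    · exact Or.inl ⟨h, h, h⟩
    · have : c = -2 * x := by linarith
      exact Or.inr (Or.inl ⟨this, this, this⟩)
  · obtain rfl : b = a := by linarith
    obtain rfl : x = -b := by linarith
    have : b = 0 := by
      rw [hh] at ha
      exact mul_self_eq_zero.1 (by linear_combination -ha / 4)
    exact Or.inr (Or.inr (Or.inr (Or.inr ⟨by linarith, by linarith, by linarith⟩)))
  · obtain rfl : c = a := by linarith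
    obtain rfl : x = -c := by linarith
    have : c = 0 := by
      rw [hh] at ha
      exact mul_self_eq_zero.1 (by linear_combination -ha / 4)
    exact Or.inr (Or.inr (Or.inr (Or.inl ⟨by linarith, by linarith, by linarith⟩)))
  · obtain rfl : b = c := by linarith
    obtain rfl : x = -b := by linarith
    have : b = 0 := by
      rw [hh] at ha
      exact mul_self_eq_zero.1 (by linear_combination -ha / 4)
    exact Or.inr (Or.inr (Or.inl ⟨by linarith, by linarith, by linarith⟩))

lemma exists_sum_eq_add (i : Fin 4) : ∃ a b c : Fin 4, a ≠ i ∧ b ≠ i ∧ c ≠ i ∧ a ≠ b ∧ a ≠ c ∧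
    b ≠ c ∧ (∀ k, k = i ∨ k = a ∨ k = b ∨ k = c) ∧
    ∀ f : Fin 4 → ℝ, ∑ k, f k = f i + f a + f b + f c := by
  have hex : ∀ i : Fin 4, ∃ a b c : Fin 4, a ≠ i ∧ b ≠ i ∧ c ≠ i ∧ a ≠ b ∧ a ≠ c ∧ b ≠ c ∧
      (∀ k, k = i ∨ k = a ∨ k = b ∨ k = c) ∧ (Finset.univ : Finset (Fin 4)) = {i, a, b, c} := by
    decide
  obtain ⟨a, b, c, hai, hbi, hci, hab, hac, hbc, hcases, huniv⟩ := hex i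
  refine ⟨a, b, c, hai, hbi, hci, hab, hac, hbc, hcases, fun f => ?_⟩
  rw [huniv, Finset.sum_insert (by simp [hai.symm, hbi.symm, hci.symm]),
    Finset.sum_insert (by simp [hab, hac]), Finset.sum_pair hbc]
  ring

/-- The multiples of `ωⱼ`, `j ≠ i`, satisfy the squared equations without giving tangent circles.
They are excluded afterwards by the second conclusion of `pairing_sq_of_areTangent`. -/
lemma descartes_weight {u : V} {i : Fin 4}
    (h : ∀ j, j ≠ i → 8 * pairing u (weight j) ^ 2 = pairing u u) :
    u = u i • weight i ∨ u = (-u i) • simpleReflection i (weight i) ∨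
      ∃ j, j ≠ i ∧ u = u j • weight j := by
  have h' : ∀ j, j ≠ i → (2 * u j - height u) ^ 2 = 2 * ∑ k, u k ^ 2 - height u ^ 2 := by
    intro j hj
    have := h j hj
    rw [pairing_symm, pairing_weight_left, pairing_self] at this
    linarith
  have hr : ∀ j, simpleReflection i (weight i) j = if j = i then -1 else 2 := by
    intro j
    by_cases hj : j = i
    · subst hj; simp [simpleReflection_apply_self, weight]
    · simp [simpleReflection_apply_of_ne hj, weight, hj]
  have hw : ∀ j, (∀ k, k ≠ j → u k = 0) → u = u j • weight j := by
    intro j hj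
    funext k
    by_cases hk : k = j
    · subst hk; simp [weight]
    · simp [weight, hk, hj k hk]
  obtain ⟨a, b, c, hai, hbi, hci, -, -, -, hcases, hsum⟩ := exists_sum_eq_add i
  have ha := h' a hai
  have hb := h' b hbi
  have hc := h' c hci
  rw [hsum] at ha hb hc
  rcases descartes ((height_apply u).trans (hsum u)) ha hb hc with
    ⟨e1, e2, e3⟩ | ⟨e1, e2, e3⟩ | ⟨e1, e2, e3⟩ | ⟨e1, e2, e3⟩ | ⟨e1, e2, e3⟩
  · refine Or.inl (hw i fun k hk => ?_)
    rcases hcases k with rfl | rfl | rfl | rfl <;> first | assumption | exact absurd rfl hk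
  · refine Or.inr (Or.inl (funext fun k => ?_))
    rw [Pi.smul_apply, hr, smul_eq_mul]
    rcases hcases k with rfl | rfl | rfl | rfl <;> simp [*, mul_comm]
  · refine Or.inr (Or.inr ⟨a, hai, hw a fun k hk => ?_⟩)
    rcases hcases k with rfl | rfl | rfl | rfl <;> first | assumption | exact absurd rfl hk
  · refine Or.inr (Or.inr ⟨b, hbi, hw b fun k hk => ?_⟩)
    rcases hcases k with rfl | rfl | rfl | rfl <;> first | assumption | exact absurd rfl hk
  · refine Or.inr (Or.inr ⟨c, hci, hw c fun k hk => ?_⟩)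
    rcases hcases k with rfl | rfl | rfl | rfl <;> first | assumption | exact absurd rfl hk

lemma eq_polarCircle_of_areTangent {w : V ≃ₗ[ℝ] V} (hw : w ∈ apollonianGroup) {i : Fin 4}
    {S : Set RP3} (hS : IsCircle S)
    (htan : ∀ j, j ≠ i → AreTangent S (polarCircle (w (weight j)))) :
    S = polarCircle (w (weight i)) ∨ S = polarCircle (w (simpleReflection i (weight i))) := by
  obtain ⟨f, hf, hSf, -⟩ := hS
  obtain ⟨u, rfl⟩ := exists_pairing_eq f
  have hu := ne_zero_of_pairing_ne_zero hf
  change S = polarCircle u at hSf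
  subst hSf
  obtain ⟨u, rfl⟩ := w.surjective u
  have hu' : u ≠ 0 := w.map_ne_zero_iff.1 hu
  have h := fun j hj => pairing_sq_of_areTangent (pairing_map_weight_self hw j) (htan j hj)
  simp only [pairing_map hw] at h
  have hsmul : ∀ (c : ℝ) (v : V), u = c • v → polarCircle (w u) = polarCircle (w v) := by
    rintro c v rfl
    rw [map_smul, polarCircle_smul]
    rintro rfl
    exact hu' (zero_smul _ _)
  rcases descartes_weight fun j hj => (h j hj).1 with h1 | h1 | ⟨j, hj, h1⟩
  · exact Or.inl (hsmul _ _ h1)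
  · exact Or.inr (hsmul _ _ h1)
  · exact absurd (by rw [← map_smul, ← h1]) ((h j hj).2 (u j))

/-! ### The packing as an orbit -/

lemma update_polarCircle (w : V ≃ₗ[ℝ] V) (i : Fin 4) :
    Function.update (fun j => polarCircle (w (weight j))) i
      (polarCircle (w (simpleReflection i (weight i)))) =
      fun j => polarCircle ((w * simpleReflection i) (weight j)) := by
  funext j
  by_cases hj : j = i
  · subst hj; simp
  · rw [Function.update_of_ne hj, LinearEquiv.mul_apply,
      simpleReflection_weight_of_ne (Ne.symm hj)]

lemma IsPackingQuadruple.exists_eq {q : Fin 4 → Set RP3} (hq : IsPackingQuadruple q) :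
    ∃ w ∈ apollonianGroup, q = fun i => polarCircle (w (weight i)) := by
  induction hq with
  | base => exact ⟨1, one_mem _, funext baseCircle_eq⟩
  | swap q i S _ hS htan hne ih =>
    obtain ⟨w, hw, rfl⟩ := ih
    rcases eq_polarCircle_of_areTangent hw hS htan with h | h
    · exact absurd h hne
    · exact ⟨w * simpleReflection i, mul_mem hw (simpleReflection_mem i), by
        rw [h, update_polarCircle]⟩

lemma isPackingQuadruple_map {w : V ≃ₗ[ℝ] V} (hw : w ∈ apollonianGroup) :
    IsPackingQuadruple fun i => polarCircle (w (weight i)) := by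
  have step : ∀ x ∈ apollonianGroup, ∀ i,
      IsPackingQuadruple (fun i => polarCircle (x (weight i))) →
      IsPackingQuadruple fun j => polarCircle ((x * simpleReflection i) (weight j)) := by
    intro x hx i hq
    have hx' := mul_mem hx (simpleReflection_mem i)
    rw [← update_polarCircle]
    refine .swap _ i _ hq (isCircle_polarCircle hx' i) (fun j hj => ?_) fun he => ?_
    · have := areTangent_polarCircle hx' hj.symm
      rwa [LinearEquiv.mul_apply, LinearEquiv.mul_apply,
        simpleReflection_weight_of_ne hj.symm] at this
    · obtain ⟨c, hc⟩ := eq_smul_of_polarCircle_subset hx he.symm.subset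
      rw [← map_smul] at hc
      have hc := w.injective (congrArg w (x.injective hc))
      obtain ⟨j, hj⟩ : ∃ j, j ≠ i := exists_ne i
      have := congrFun hc j
      rw [simpleReflection_apply_of_ne hj] at this
      simp [weight, hj] at this
  -- Swaps multiply `w` on the right, so words are built from that side.
  induction hw using Subgroup.closure_induction_right with
  | one =>
    have : baseCircle = fun i => polarCircle ((1 : V ≃ₗ[ℝ] V) (weight i)) := funext baseCircle_eq
    rw [← this]; exact .base
  | mul_right x hx y hy ih =>
    obtain ⟨k, rfl⟩ := hy
    exact step x hx k ih
  | mul_inv_cancel x hx y hy ih =>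
    obtain ⟨k, rfl⟩ := hy
    rw [inv_eq_of_mul_eq_one_left (simpleReflection_mul_self k)]
    exact step x hx k ih

/-- The circles of the packing are the polar circles of the orbits of the fundamental weights. -/
lemma mem_packing_iff {S : Set RP3} :
    S ∈ packing ↔ ∃ w ∈ apollonianGroup, ∃ i, S = polarCircle (w (weight i)) := by
  constructor
  · rintro ⟨q, hq, i, rfl⟩
    obtain ⟨w, hw, rfl⟩ := hq.exists_eq
    exact ⟨w, hw, i, rfl⟩
  · rintro ⟨w, hw, i, rfl⟩
    exact ⟨_, isPackingQuadruple_map hw, i, rfl⟩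

/-! ### Spherical caps -/

/-- The part of the lightlike sphere on the positive side of the polar plane of `v`. -/
def polarCap (v : V) : Set RP3 := {P ∈ lightlike | 0 < pairing v (affineRep P)}

lemma mk_mem_polarCap {v x : V} (hx : x ≠ 0) (hpos : 0 < height x) :
    Projectivization.mk ℝ x hx ∈ polarCap v ↔ pairing x x = 0 ∧ 0 < pairing v x := by
  rw [polarCap, Set.mem_ofPred_eq, mk_mem_lightlike, affineRep_mk, map_smul, smul_eq_mul,
    mul_pos_iff_of_pos_left (inv_pos.2 hpos)]

lemma exists_mk_eq_of_mem_lightlike {P : RP3} (hP : P ∈ lightlike) :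
    ∃ (x : V) (hx : x ≠ 0), P = Projectivization.mk ℝ x hx ∧ pairing x x = 0 ∧ height x = 1 := by
  induction P using Projectivization.ind with
  | h x hx =>
    rw [mk_mem_lightlike] at hP
    have hh : height x ≠ 0 := by
      intro h0
      apply hx
      rw [pairing_self, h0] at hP
      have : ∑ i, x i ^ 2 = 0 := by linarith
      funext i
      have := (Finset.sum_eq_zero_iff_of_nonneg fun i _ => sq_nonneg (x i)).1 this i
        (Finset.mem_univ i)
      exact pow_eq_zero_iff two_ne_zero |>.1 this
    refine ⟨(height x)⁻¹ • x, smul_ne_zero (inv_ne_zero hh) hx, ?_, by simp [hP], by simp [hh]⟩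
    exact (mk_eq_mk_of_eq_smul _ _ rfl).symm

lemma isOpenCap_polarCap {v : V} (hv : v ≠ 0) : IsOpenCap (polarCircle v) (polarCap v) :=
  ⟨pairing v, pairing_ne_zero hv, rfl, rfl⟩

lemma polarCap_smul {c : ℝ} (hc : 0 < c) (v : V) : polarCap (c • v) = polarCap v := by
  ext P
  simp [polarCap, hc]

lemma IsOpenCap.eq_or_eq {w : V ≃ₗ[ℝ] V} (hw : w ∈ apollonianGroup) {i : Fin 4} {O : Set RP3}
    (hO : IsOpenCap (polarCircle (w (weight i))) O) :
    O = polarCap (w (weight i)) ∨ O = polarCap (-w (weight i)) := by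
  obtain ⟨f, hf, hS, rfl⟩ := hO
  obtain ⟨u, rfl⟩ := exists_pairing_eq f
  have hu := ne_zero_of_pairing_ne_zero hf
  obtain ⟨c, rfl⟩ := eq_smul_of_polarCircle_subset hw (Set.Subset.antisymm_iff.1 hS).1
  change polarCap _ = _ ∨ polarCap _ = _
  rcases lt_trichotomy c 0 with hc | rfl | hc
  · right
    rw [← polarCap_smul (neg_pos.2 hc) (-w (weight i)), smul_neg, neg_smul, neg_neg]
  · exact absurd (zero_smul _ _) hu
  · exact Or.inl (polarCap_smul hc _)

lemma disjoint_polarCap {w w' : V ≃ₗ[ℝ] V} (hw : w ∈ apollonianGroup)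
    (hw' : w' ∈ apollonianGroup) {i j : Fin 4} (hne : w (weight i) ≠ w' (weight j)) :
    Disjoint (polarCap (w (weight i))) (polarCap (w' (weight j))) := by
  rw [Set.disjoint_left]
  intro P hP hP'
  obtain ⟨x, hx, rfl, hxx, hxh⟩ := exists_mk_eq_of_mem_lightlike hP.1
  have hx0 : 0 < height x := by rw [hxh]; norm_num
  rw [mk_mem_polarCap hx hx0] at hP hP'
  have hle : pairing (w (weight i)) (w' (weight j)) ≤ -1 / 8 := by
    have h := pairing_weight_map_le (mul_mem (inv_mem hw) hw') (i := i) (j := j) fun h => hne (by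
      rw [← h, LinearEquiv.mul_apply]
      exact LinearEquiv.apply_symm_apply w _)
    rw [← pairing_map hw, LinearEquiv.mul_apply] at h
    rwa [show w (w⁻¹ (w' (weight j))) = w' (weight j) from
      LinearEquiv.apply_symm_apply w _] at h
  have h0 : pairing (w (weight i) + w' (weight j)) x ≤ 0 := by
    refine pairing_nonpos_of_causal ?_ ?_ hxx.le hx0.le
    · simp only [map_add, LinearMap.add_apply, pairing_map_weight_self hw,
        pairing_map_weight_self hw', pairing_symm (w' (weight j)) (w (weight i))]
      linarith
    · rw [map_add]
      exact add_nonneg (height_map_pos hw (weight_mem_closedChamber i) (weight_ne_zero i)).le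
        (height_map_pos hw' (weight_mem_closedChamber j) (weight_ne_zero j)).le
  rw [map_add, LinearMap.add_apply] at h0
  linarith [hP.2, hP'.2]

lemma mk_map_mem_polarCap {w : V ≃ₗ[ℝ] V} (hw : w ∈ apollonianGroup) {x : V} (v : V)
    (hx : x ≠ 0) (hxc : x ∈ closedChamber) (hxx : pairing x x = 0) (hvx : 0 < pairing v x) :
    Projectivization.mk ℝ (w x) (w.map_ne_zero_iff.2 hx) ∈ polarCap (w v) := by
  rw [mk_mem_polarCap _ (height_map_pos hw hxc hx), pairing_map hw, pairing_map hw]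
  exact ⟨hxx, hvx⟩

/-- This forces the choice of caps: if one circle took the side away from its pole, neither cap of a
tangent circle would be disjoint from it. -/
lemma not_disjoint_polarCap_neg {w : V ≃ₗ[ℝ] V} (hw : w ∈ apollonianGroup) {i j : Fin 4}
    (hij : i ≠ j) :
    ¬ Disjoint (polarCap (-w (weight i))) (polarCap (w (weight j))) ∧
      ¬ Disjoint (polarCap (-w (weight i))) (polarCap (-w (weight j))) := by
  obtain ⟨k, l, hki, hkj, hli, hlj, hkl⟩ : ∃ k l : Fin 4, k ≠ i ∧ k ≠ j ∧ l ≠ i ∧ l ≠ j ∧ k ≠ l := by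
    revert i j; decide
  have hc : ∀ {a b : V}, a ∈ closedChamber → b ∈ closedChamber → a + b ∈ closedChamber :=
    fun ha hb m => add_nonneg (ha m) (hb m)
  have hk := hc (weight_mem_closedChamber k) (weight_mem_closedChamber l)
  have hj4 : (4 : ℝ) • weight j ∈ closedChamber := fun m =>
    mul_nonneg (by norm_num) (weight_mem_closedChamber j m)
  -- The coefficient `4` is the nonzero root of `c²/8 - c/2 = 0`, which makes `ωₖ + ωₗ + c ωⱼ`
  -- lightlike.
  have hne : (weight k + weight l) + (4 : ℝ) • weight j ≠ 0 := by
    intro h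
    have := congrArg height h
    simp only [map_add, map_smul, height_weight, map_zero, smul_eq_mul] at this
    norm_num at this
  refine ⟨Set.not_disjoint_iff.2 ⟨Projectivization.mk ℝ _ (w.map_ne_zero_iff.2 hne), ?_, ?_⟩,
    Set.not_disjoint_iff.2 ⟨Projectivization.mk ℝ _ (map_weight_add_weight_ne_zero w k l),
      ?_, ?_⟩⟩
  all_goals try rw [← map_neg]
  · apply mk_map_mem_polarCap hw _ hne (hc hk hj4) <;>
    simp only [map_add, map_smul, map_neg, LinearMap.add_apply, LinearMap.smul_apply,
      LinearMap.neg_apply, smul_eq_mul, pairing_weight_self, pairing_weight_of_ne hkl,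
      pairing_weight_of_ne hkl.symm, pairing_weight_of_ne hkj, pairing_weight_of_ne hkj.symm,
      pairing_weight_of_ne hlj, pairing_weight_of_ne hlj.symm, pairing_weight_of_ne hij,
      pairing_weight_of_ne hki.symm, pairing_weight_of_ne hli.symm] <;> norm_num
  · apply mk_map_mem_polarCap hw _ hne (hc hk hj4) <;>
    simp only [map_add, map_smul, LinearMap.add_apply, LinearMap.smul_apply,
      smul_eq_mul, pairing_weight_self, pairing_weight_of_ne hkl,
      pairing_weight_of_ne hkl.symm, pairing_weight_of_ne hkj, pairing_weight_of_ne hkj.symm,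
      pairing_weight_of_ne hlj, pairing_weight_of_ne hlj.symm] <;> norm_num
  · apply mk_map_mem_polarCap hw _ (weight_add_weight_ne_zero k l) hk <;>
    simp only [map_add, map_neg, LinearMap.add_apply, LinearMap.neg_apply, pairing_weight_self,
      pairing_weight_of_ne hkl, pairing_weight_of_ne hkl.symm, pairing_weight_of_ne hki.symm,
      pairing_weight_of_ne hli.symm] <;> norm_num
  · apply mk_map_mem_polarCap hw _ (weight_add_weight_ne_zero k l) hk <;>
    simp only [map_add, map_neg, LinearMap.add_apply, LinearMap.neg_apply, pairing_weight_self,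
      pairing_weight_of_ne hkl, pairing_weight_of_ne hkl.symm, pairing_weight_of_ne hkj.symm,
      pairing_weight_of_ne hlj.symm] <;> norm_num

lemma IsCapChoice.eq_polarCap {O : packing → Set RP3} (hO : IsCapChoice O) (S : packing)
    {w : V ≃ₗ[ℝ] V} (hw : w ∈ apollonianGroup) {i : Fin 4}
    (hS : (S : Set RP3) = polarCircle (w (weight i))) : O S = polarCap (w (weight i)) := by
  have h := hO.1 S
  rw [hS] at h
  refine (IsOpenCap.eq_or_eq hw h).resolve_right fun hneg => ?_
  obtain ⟨j, hj⟩ := exists_ne i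
  let S' : packing := ⟨polarCircle (w (weight j)), mem_packing_iff.2 ⟨w, hw, j, rfl⟩⟩
  have hSS' : S ≠ S' := by
    intro he
    refine (areTangent_polarCircle hw hj.symm).ne (polarCircle_nontrivial hw i) ?_
    rw [← hS, he]
  have hd := hO.2 S S' hSS'
  obtain ⟨h1, h2⟩ := not_disjoint_polarCap_neg hw hj.symm
  rcases IsOpenCap.eq_or_eq hw (hO.1 S') with h' | h' <;> rw [hneg, h'] at hd
  · exact h1 hd
  · exact h2 hd

lemma existsUnique_isCapChoice : ∃! O : packing → Set RP3, IsCapChoice O := by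
  choose w hw i hi using fun S : packing => mem_packing_iff.1 S.2
  refine ⟨fun S => polarCap (w S (weight (i S))), ⟨fun S => ?_, fun S S' hne => ?_⟩, ?_⟩
  · rw [hi S]; exact isOpenCap_polarCap (map_weight_ne_zero _ _)
  · refine disjoint_polarCap (hw S) (hw S') fun h => hne (Subtype.ext ?_)
    rw [hi S, hi S', h]
  · intro O hO
    funext S
    exact hO.eq_polarCap S (hw S) (hi S)

/-! ### Line segments and faces of the simplices -/

lemma mk_mem_lineSegment {u x : V} (hu : u ≠ 0) (hx : x ≠ 0) (hu' : 0 < height u)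
    (hx' : 0 < height x) {a b : ℝ} (ha : 0 ≤ a) (hb : 0 ≤ b) (h0 : a • u + b • x ≠ 0) :
    Projectivization.mk ℝ _ h0 ∈
      lineSegment (Projectivization.mk ℝ u hu) (Projectivization.mk ℝ x hx) := by
  have hH : 0 < a * height u + b * height x := by
    refine lt_of_le_of_ne (by positivity) fun h => h0 ?_
    have h1 : a * height u = 0 := by nlinarith [mul_nonneg ha hu'.le, mul_nonneg hb hx'.le]
    have h2 : b * height x = 0 := by linarith
    rw [(mul_eq_zero.1 h1).resolve_right hu'.ne', (mul_eq_zero.1 h2).resolve_right hx'.ne']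
    simp
  refine ⟨(a * height u + b * height x)⁻¹ • (a • u + b • x), ?_,
    smul_ne_zero (inv_ne_zero hH.ne') h0, mk_eq_mk_of_eq_smul _ _ rfl⟩
  rw [affineRep_mk, affineRep_mk]
  refine ⟨(a * height u) / (a * height u + b * height x),
    (b * height x) / (a * height u + b * height x), by positivity, by positivity, ?_, ?_⟩
  · rw [← add_div, div_self hH.ne']
  · rw [smul_add, smul_smul, smul_smul, smul_smul, smul_smul]
    congr 2 <;> field_simp

lemma exists_of_mem_lineSegment {u x : V} {hu : u ≠ 0} {hx : x ≠ 0} (hu' : 0 < height u)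
    (hx' : 0 < height x) {P : RP3}
    (hP : P ∈ lineSegment (Projectivization.mk ℝ u hu) (Projectivization.mk ℝ x hx)) :
    ∃ (a b : ℝ) (h0 : a • u + b • x ≠ 0), 0 ≤ a ∧ 0 ≤ b ∧ P = Projectivization.mk ℝ _ h0 := by
  obtain ⟨y, hy, hy0, rfl⟩ := hP
  rw [affineRep_mk, affineRep_mk] at hy
  obtain ⟨a, b, ha, hb, -, rfl⟩ := hy
  simp only [smul_smul] at hy0 ⊢
  exact ⟨_, _, hy0, by positivity, by positivity, rfl⟩

lemma height_map_weight_pos {w : V ≃ₗ[ℝ] V} (hw : w ∈ apollonianGroup) (i : Fin 4) :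
    0 < height (w (weight i)) :=
  height_map_pos hw (weight_mem_closedChamber i) (weight_ne_zero i)

lemma simplexFace_singleton (w : V ≃ₗ[ℝ] V) (i : Fin 4) :
    simplexFace w {i} = {Projectivization.mk ℝ _ (map_weight_ne_zero w i)} := by
  ext P
  constructor
  · rintro ⟨_, ⟨s, ⟨-, hs⟩, rfl⟩, hv, rfl⟩
    have : s = s i • weight i := by
      funext k
      by_cases hk : k = i
      · subst hk; simp [weight]
      · simp [weight, hk, hs k hk]
    refine mk_eq_mk_of_eq_smul _ _ (c := s i) ?_
    rw [← map_smul, ← this]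
  · rintro rfl
    exact ⟨_, ⟨weight i, ⟨weight_mem_closedChamber i, fun k hk => by
      have : k ≠ i := hk
      simp [weight, this]⟩, rfl⟩, _, rfl⟩

lemma simplexFace_pair {w : V ≃ₗ[ℝ] V} (hw : w ∈ apollonianGroup) {i j : Fin 4} (hij : i ≠ j) :
    simplexFace w {i, j} = lineSegment (Projectivization.mk ℝ _ (map_weight_ne_zero w i))
      (Projectivization.mk ℝ _ (map_weight_ne_zero w j)) := by
  ext P
  constructor
  · rintro ⟨_, ⟨s, ⟨hs, hs0⟩, rfl⟩, hv, rfl⟩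
    have hse : s = s i • weight i + s j • weight j := by
      funext k
      by_cases hki : k = i
      · subst hki; simp [weight, hij]
      · by_cases hkj : k = j
        · subst hkj; simp [weight, hij.symm]
        · simp [weight, hki, hkj, hs0 k (by simp [hki, hkj])]
    have hwe : w s = s i • w (weight i) + s j • w (weight j) := by
      rw [← map_smul, ← map_smul, ← map_add, ← hse]
    simp only [hwe]
    exact mk_mem_lineSegment _ _ (height_map_weight_pos hw i) (height_map_weight_pos hw j)
      (hs i) (hs j) _
  · intro hP
    obtain ⟨a, b, h0, ha, hb, rfl⟩ :=
      exists_of_mem_lineSegment (height_map_weight_pos hw i) (height_map_weight_pos hw j) hP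
    refine ⟨_, ⟨a • weight i + b • weight j, ⟨fun k => ?_, fun k hk => ?_⟩, ?_⟩, h0, rfl⟩
    · exact add_nonneg (mul_nonneg ha (weight_mem_closedChamber i k))
        (mul_nonneg hb (weight_mem_closedChamber j k))
    · simp only [Set.mem_insert_iff, Set.mem_singleton_iff, not_or] at hk
      simp [weight, hk.1, hk.2]
    · simp

/-! ### The Apollonian cone as a union of the ball and bounded cones -/

lemma add_smul_weight_mem_chamber {s : V} (hs : s ∈ chamber) {c : ℝ} (hc : 0 ≤ c) (i : Fin 4) :
    s + c • weight i ∈ chamber := by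
  have hle : ∀ k, s k ≤ (s + c • weight i) k := fun k =>
    le_add_of_nonneg_right (mul_nonneg hc (weight_mem_closedChamber i k))
  exact ⟨fun k => (hs.1 k).trans (hle k), fun k l hk hl =>
    hs.2 k l (le_antisymm (hk ▸ hle k) (hs.1 k)) (le_antisymm (hl ▸ hle l) (hs.1 l))⟩

/-- A lightlike vector in the open cap polar to `w ωᵢ` can be moved into the chamber, up to adding
a nonnegative multiple of `w ωᵢ`. -/
lemma exists_map_chamber_of_cap {w : V ≃ₗ[ℝ] V} (hw : w ∈ apollonianGroup) {i : Fin 4} {x : V}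
    (hx : pairing x x = 0) (hpos : 0 < height x) (hix : 0 < pairing (w (weight i)) x) {c : ℝ}
    (hc : 0 ≤ c) : ∃ g ∈ apollonianGroup, ∃ t ∈ chamber, g t = c • w (weight i) + x := by
  obtain ⟨z, rfl⟩ := w.surjective x
  have hz0 : 0 < height z := by
    have := height_map_pos_of_causal (inv_mem hw) hx.le hpos
    rwa [show w⁻¹ (w z) = z from LinearEquiv.symm_apply_apply w z] at this
  rw [pairing_map hw] at hx hix
  set d := pairing (weight i) z with hd
  -- The projection of `z` orthogonal to `ωᵢ`; the factor `8` is `1 / (ωᵢ, ωᵢ)`. Its norm is `-8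
  -- d²`.
  set y := z - (8 * d) • weight i with hy
  have hiy : pairing (weight i) y = 0 := by
    rw [hy, map_sub, map_smul, pairing_weight_self, ← hd, smul_eq_mul]; ring
  have hyy : pairing y y < 0 := by
    have : pairing y y = -(8 * d ^ 2) := by
      rw [hy]
      simp only [map_sub, map_smul, LinearMap.sub_apply, LinearMap.smul_apply, pairing_weight_self,
        pairing_symm z (weight i), hx, ← hd, smul_eq_mul]
      ring
    rw [this]
    have := pow_pos hix 2
    linarith
  have hyh : 0 < height y := by
    rw [hy, map_sub, map_smul, height_weight, hd, pairing_weight_left, smul_eq_mul]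
    -- The height of `y` is `2 (height z - z i)`, and `z i ^ 2 ≤ height z ^ 2 / 2` because `z` is
    -- lightlike.
    have h1 : z i ^ 2 ≤ ∑ k, z k ^ 2 :=
      Finset.single_le_sum (f := fun k => z k ^ 2) (fun k _ => sq_nonneg _) (Finset.mem_univ i)
    rw [pairing_self] at hx
    nlinarith
  obtain ⟨g, hg, hgy, hgf⟩ := exists_map_mem_chamber hyy hyh
  refine ⟨w * g⁻¹, mul_mem hw (inv_mem hg), g y + (c + 8 * d) • weight i,
    add_smul_weight_mem_chamber hgy (by positivity) i, ?_⟩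
  have he : g y + (c + 8 * d) • weight i = g (y + (c + 8 * d) • weight i) := by
    rw [map_add, map_smul, hgf i hiy]
  rw [LinearEquiv.mul_apply, he, show g⁻¹ (g (y + (c + 8 * d) • weight i)) =
    y + (c + 8 * d) • weight i from LinearEquiv.symm_apply_apply g _, ← map_smul, ← map_add]
  congr 1
  rw [hy]
  module

/-- For a vector with coordinates `m, a, b, c`, the conclusion says that it is timelike. If `p` is
the largest of `a, b, c` and `q, r` are the others, then `a + b + c - m ≤ q + r`, and `(q + r)² ≤ p
q + p r + 2 q r`. -/
lemma sum_sub_sq_lt {m a b c : ℝ} (ha : 0 ≤ a) (hb : 0 ≤ b) (hc : 0 ≤ c) (ham : a ≤ m)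
    (hbm : b ≤ m) (hcm : c ≤ m) (hm : m ≤ a + b + c) (he : 0 < a * b + a * c + b * c) :
    (a + b + c - m) ^ 2 < 4 * (a * b + a * c + b * c) := by
  have key : ∀ p q r : ℝ, 0 ≤ p → 0 ≤ q → 0 ≤ r → q ≤ p → r ≤ p → p ≤ m → m ≤ p + q + r →
      0 < p * q + p * r + q * r → (p + q + r - m) ^ 2 < 4 * (p * q + p * r + q * r) := by
    intro p q r hp hq hr hqp hrp hpm hm he
    have h1 : (p + q + r - m) ^ 2 ≤ (q + r) ^ 2 :=
      pow_le_pow_left₀ (by linarith) (by linarith) 2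
    nlinarith [mul_nonneg hq (sub_nonneg.2 hqp), mul_nonneg hr (sub_nonneg.2 hrp),
      mul_nonneg hp hq, mul_nonneg hp hr]
  rcases le_total a b with h1 | h1 <;> rcases le_total a c with h2 | h2 <;>
    rcases le_total b c with h3 | h3
  · have := key c a b hc ha hb h2 h3 hcm (by linarith) (by linarith); linarith
  · have := key b a c hb ha hc h1 h3 hbm (by linarith) (by linarith); linarith
  · have := key c a b hc ha hb (by linarith) h3 hcm (by linarith) (by linarith); linarith
  · have := key b a c hb ha hc h1 h3 hbm (by linarith) (by linarith); linarith
  · have := key c a b hc ha hb h2 h3 hcm (by linarith) (by linarith); linarith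
  · have := key c a b hc ha hb h2 (by linarith) hcm (by linarith) (by linarith); linarith
  · exact key a b c ha hb hc h1 h2 ham hm he
  · exact key a b c ha hb hc h1 h2 ham hm he

/-- A vector of the chamber outside of the light cone is the sum of a nonnegative multiple of some
`ωᵢ` and of a lightlike vector of the closed chamber in the cap polar to `ωᵢ`. -/
lemma exists_eq_smul_weight_add {y : V} (hy : y ∈ chamber) (hyy : 0 ≤ pairing y y) :
    ∃ (i : Fin 4) (c : ℝ) (x : V), 0 ≤ c ∧ x ∈ closedChamber ∧ pairing x x = 0 ∧
      0 < pairing (weight i) x ∧ y = c • weight i + x := by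
  obtain ⟨i, hi⟩ := Finite.exists_max y
  obtain ⟨a, b, c, hai, hbi, hci, hab, hac, hbc, -, hsum⟩ := exists_sum_eq_add i
  have ha := hy.1 a
  have hb := hy.1 b
  have hc := hy.1 c
  have he : 0 < y a * y b + y a * y c + y b * y c := by
    have h1 := mul_nonneg ha hb
    have h2 := mul_nonneg ha hc
    have h3 := mul_nonneg hb hc
    refine lt_of_le_of_ne (by positivity) fun h0 => ?_
    have e1 : y a * y b = 0 := by linarith
    have e2 : y a * y c = 0 := by linarith
    have e3 : y b * y c = 0 := by linarith
    rcases mul_eq_zero.1 e1 with e | e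
    · rcases mul_eq_zero.1 e3 with e' | e'
      · exact hab (hy.2 a b e e')
      · exact hac (hy.2 a c e e')
    · rcases mul_eq_zero.1 e2 with e' | e'
      · exact hab (hy.2 a b e' e)
      · exact hbc (hy.2 b c e e')
  have hyy' : 4 * (y a * y b + y a * y c + y b * y c) ≤ (y a + y b + y c - y i) ^ 2 := by
    rw [pairing_self, height_apply, hsum, hsum] at hyy
    linarith
  have hlt : y a + y b + y c < y i := by
    by_contra! h
    linarith [sum_sub_sq_lt ha hb hc (hi a) (hi b) (hi c) h he]
  -- On the line `y + ℝ ωᵢ` the norm vanishes where the `i`-th coordinate differs from the sum of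
  -- the other three by `± r`. The plus sign gives `8 (ωᵢ, x) = r > 0`.
  set r := √(4 * (y a * y b + y a * y c + y b * y c)) with hr
  have hr0 : 0 < r := Real.sqrt_pos.2 (by linarith)
  have hr2 : r ^ 2 = 4 * (y a * y b + y a * y c + y b * y c) := Real.sq_sqrt (by linarith)
  have hle : r ≤ y i - (y a + y b + y c) := by
    refine abs_le_of_sq_le_sq' (by rw [hr2]; linarith) (by linarith) |>.2
  set d := y i - (y a + y b + y c) - r with hd
  have hxk : ∀ k, k ≠ i → (y - d • weight i) k = y k := fun k hk => by simp [weight, hk]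
  have hxi : (y - d • weight i) i = y a + y b + y c + r := by simp [weight, hd]; ring
  refine ⟨i, d, y - d • weight i, by linarith, fun k => ?_, ?_, ?_, by module⟩
  · by_cases hk : k = i
    · subst hk; rw [hxi]; linarith
    · rw [hxk k hk]; exact hy.1 k
  · rw [pairing_self, height_apply, hsum, hsum, hxi, hxk a hai, hxk b hbi, hxk c hci]
    linarith
  · rw [pairing_weight_left, height_apply, hsum, hxi, hxk a hai, hxk b hbi, hxk c hci]
    linarith

lemma mk_mem_apollonianCone {w : V ≃ₗ[ℝ] V} (hw : w ∈ apollonianGroup) {s y : V}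
    (hs : s ∈ chamber) (hy : y ≠ 0) (h : w s = y) :
    Projectivization.mk ℝ y hy ∈ apollonianCone :=
  ⟨y, Set.mem_iUnion₂.2 ⟨w, hw, s, hs, h⟩, hy, rfl⟩

lemma timelike_subset_apollonianCone : timelike ⊆ apollonianCone := by
  intro P hP
  induction P using Projectivization.ind with
  | h v hv =>
    rw [mk_mem_timelike] at hP
    have key : ∀ (u : V) (hu : u ≠ 0), pairing u u < 0 → 0 < height u →
        Projectivization.mk ℝ u hu ∈ apollonianCone := by
      intro u hu huu hpos
      obtain ⟨w, hw, hc, -⟩ := exists_map_mem_chamber huu hpos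
      exact mk_mem_apollonianCone (inv_mem hw) hc hu (LinearEquiv.symm_apply_apply w u)
    rcases lt_trichotomy (height v) 0 with h | h | h
    · rw [mk_eq_mk_of_eq_smul hv (neg_ne_zero.2 hv) (c := -1) (by simp)]
      exact key _ _ (by simpa using hP) (by simpa using h)
    · rw [pairing_self, h] at hP
      have : 0 ≤ ∑ i, v i ^ 2 := Finset.sum_nonneg fun i _ => sq_nonneg _
      linarith
    · exact key v hv hP h

lemma boundedCone_subset_apollonianCone {w : V ≃ₗ[ℝ] V} (hw : w ∈ apollonianGroup) (i : Fin 4) :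
    boundedCone (Projectivization.mk ℝ _ (map_weight_ne_zero w i)) (polarCap (w (weight i))) ⊆
      apollonianCone := by
  intro P hP
  obtain ⟨Q, hQ, hPQ, hne⟩ := Set.mem_iUnion₂.1 hP
  obtain ⟨x, hx, rfl, hxx, hxh⟩ := exists_mk_eq_of_mem_lightlike hQ.1
  have hx0 : 0 < height x := by rw [hxh]; norm_num
  obtain ⟨a, b, h0, ha, hb, rfl⟩ := exists_of_mem_lineSegment (height_map_weight_pos hw i) hx0 hPQ
  rw [mk_mem_polarCap hx hx0] at hQ
  -- Here the removal of the apex enters: `b = 0` would give the apex itself.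
  have hb' : 0 < b := by
    refine lt_of_le_of_ne hb ?_
    rintro rfl
    exact hne (mk_eq_mk_of_eq_smul _ _ (c := a) (by simp))
  obtain ⟨g, hg, t, ht, h⟩ := exists_map_chamber_of_cap hw (x := b • x) (i := i) (c := a)
    (by simp [hxx]) (by simp [hxh, hb']) (by simp [hb', hQ.2]) ha
  exact mk_mem_apollonianCone hg ht h0 h

lemma exists_mem_boundedCone {w : V ≃ₗ[ℝ] V} (hw : w ∈ apollonianGroup) {s : V}
    (hs : s ∈ chamber) (hss : 0 ≤ pairing s s) (h0 : w s ≠ 0) :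
    ∃ i, Projectivization.mk ℝ _ h0 ∈
      boundedCone (Projectivization.mk ℝ _ (map_weight_ne_zero w i)) (polarCap (w (weight i))) := by
  obtain ⟨i, c, x, hc, hx, hxx, hix, rfl⟩ := exists_eq_smul_weight_add hs hss
  have hx0 : x ≠ 0 := by
    rintro rfl
    simp at hix
  have hwx0 : w x ≠ 0 := w.map_ne_zero_iff.2 hx0
  refine ⟨i, Set.mem_iUnion₂.2 ⟨_, mk_map_mem_polarCap hw (weight i) hx0 hx hxx hix, ?_, ?_⟩⟩
  · have he : w (c • weight i + x) = c • w (weight i) + (1 : ℝ) • w x := by simp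
    simp only [he]
    exact mk_mem_lineSegment _ _ (height_map_weight_pos hw i) (height_map_pos hw hx hx0) hc
      zero_le_one _
  · intro he
    obtain ⟨k, hk⟩ := exists_smul_of_mk_eq_mk he
    rw [← map_smul] at hk
    have hxe : x = (k - c) • weight i := by
      rw [sub_smul, ← w.injective hk]; simp
    have hz : (k - c) * ((k - c) * (1 / 8)) = 0 := by
      rw [← hxx]
      conv_rhs => rw [hxe]
      simp only [map_smul, LinearMap.smul_apply, pairing_weight_self, smul_eq_mul]
    have : k - c = 0 := by
      rcases mul_eq_zero.1 hz with h | h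
      · exact h
      · linarith
    exact hx0 (by rw [hxe, this, zero_smul])

end ApollonianCone

theorem theorem5p2 :
    (∀ S : packing, ∃! p : RP3, IsTangentApex (S : Set RP3) p) ∧
    (∃! O : packing → Set RP3, IsCapChoice O) ∧
    ∀ (p : packing → RP3) (O : packing → Set RP3),
      (∀ S : packing, IsTangentApex (S : Set RP3) (p S)) → IsCapChoice O →
        apollonianCone = timelike ∪ ⋃ S : packing, boundedCone (p S) (O S) ∧
        (∀ w ∈ apollonianGroup, ∀ i : Fin 4, ∃ S : packing, simplexFace w {i} = {p S}) ∧
        (∀ w ∈ apollonianGroup, ∀ i j : Fin 4, i ≠ j → ∃ S S' : packing,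
          AreTangent (S : Set RP3) (S' : Set RP3) ∧
            simplexFace w {i, j} = lineSegment (p S) (p S')) := by
  refine ⟨fun S => ?_, existsUnique_isCapChoice, fun p O hp hO => ?_⟩
  · obtain ⟨w, hw, i, hS⟩ := mem_packing_iff.1 S.2
    rw [hS]
    exact ⟨_, (isTangentApex_polarCircle hw i _).2 rfl,
      fun p h => (isTangentApex_polarCircle hw i p).1 h⟩
  -- By uniqueness, any admissible apexes and caps are the poles and polar caps of orbit vectors,
  -- whichever `w` and `i` represent the circle.
  have hpS : ∀ (S : packing) (w : V ≃ₗ[ℝ] V), w ∈ apollonianGroup → ∀ i,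
      (S : Set RP3) = polarCircle (w (weight i)) →
      p S = Projectivization.mk ℝ _ (map_weight_ne_zero w i) := fun S w hw i h =>
    (isTangentApex_polarCircle hw i _).1 (h ▸ hp S)
  have circle : ∀ w ∈ apollonianGroup, ∀ i, ∃ S : packing,
      (S : Set RP3) = polarCircle (w (weight i)) := fun w hw i =>
    ⟨⟨_, mem_packing_iff.2 ⟨w, hw, i, rfl⟩⟩, rfl⟩
  refine ⟨Set.Subset.antisymm ?_ ?_, fun w hw i => ?_, fun w hw i j hij => ?_⟩
  · rintro P ⟨v, hv, hv0, rfl⟩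
    obtain ⟨w, hw, s, hs, rfl⟩ := Set.mem_iUnion₂.1 hv
    rcases lt_or_ge (pairing s s) 0 with hss | hss
    · left
      rwa [mk_mem_timelike, pairing_map hw]
    · right
      obtain ⟨i, hi⟩ := exists_mem_boundedCone hw hs hss hv0
      obtain ⟨S, hS⟩ := circle w hw i
      refine Set.mem_iUnion.2 ⟨S, ?_⟩
      rwa [hpS S w hw i hS, hO.eq_polarCap S hw hS]
  · refine Set.union_subset timelike_subset_apollonianCone (Set.iUnion_subset fun S => ?_)
    obtain ⟨w, hw, i, hS⟩ := mem_packing_iff.1 S.2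
    rw [hpS S w hw i hS, hO.eq_polarCap S hw hS]
    exact boundedCone_subset_apollonianCone hw i
  · obtain ⟨S, hS⟩ := circle w hw i
    exact ⟨S, by rw [hpS S w hw i hS, simplexFace_singleton]⟩
  · obtain ⟨S, hS⟩ := circle w hw i
    obtain ⟨S', hS'⟩ := circle w hw j
    refine ⟨S, S', ?_, ?_⟩
    · rw [hS, hS']; exact areTangent_polarCircle hw hij
    · rw [hpS S w hw i hS, hpS S' w hw j hS', simplexFace_pair hw hij]
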